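/- Fix $\beta>0$ and let $M_\beta(z)=\frac{z-i\beta}{z+i\beta}$, $T(\theta)=M_\beta^{-1}(e^{i\theta})$ for $0<\theta<2\pi$. For a continuous $f:\mathbb R\to\mathbb C$ in $H^1(\mathbb R)$ let $F$ be the $2\pi$-periodic function $F(\theta)=f(T(\theta))$ for $\theta\notin 2\pi\mathbb Z$, $F(\theta)=0$ for $\theta\in 2\pi\mathbb Z$ (the value of $f$ at infinity). For $n\ge 1$ put $\theta_l=2\pi l/n$, $\tilde F_j=\frac1n\sum_{l=0}^{n-1}e^{-ij\theta_l}F(\theta_l)$, and let $$\mathcal R_nf(x)=\sum_{j=-\lfloor (n-1)/2\rfloor}^{\lfloor n/2\rfloor}\tilde F_j\,M_\beta(x)^j$$ be the rational interpolant of $f$. Use the norms $$\|F\|_{H^s(\mathbb T)}^2=\sum_{j\in\mathbb Z}(1+|j|)^{2s}|\hat F_j|^2,\qquad \|f\|_{H^s(\mathbb R)}^2=\int_{\mathbb R}(1+|\xi|)^{2s}|\mathcal Ff(\xi)|^2\,d\xi,$$ where $\hat F_j=\frac1{2\pi}\int_0^{2\pi}e^{-ij\theta}F(\theta)\,d\theta$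 and $\mathcal Ff(\xi)=\int_{\mathbb R}e^{-i\xi x}f(x)\,dx$ (extended to $L^2$), and the usual norm on $L^2(\mathbb R)$. For $k\in\mathbb R$ and $z\in\mathbb C\setminus\mathbb R$ let $$\mathcal C_{\mathbb R,k}f(z)=\frac1{2\pi i}\int_{\mathbb R}\frac{e^{-ikx}f(x)}{x-z}\,dx,\qquad \mathcal C_{\mathbb R,k,n}f=\mathcal C_{\mathbb R,k}\mathcal R_nf,$$ with boundary values $\mathcal C^{\pm}f(x)=\lim_{\eta\to0^+}\mathcal Cf(x\pm i\eta)$. For $\delta>0$ and a choice of sign let $E^{\pm}_{n,\delta}(x)=(\mathcal C_{\mathbb R,k}-\mathcal C_{\mathbb R,k,n})f(x\pm i\delta)$, and let $E^\pm_{n,0}=\mathcal C^\pm_{\mathbb R,k}f-\mathcal C^\pm_{\mathbb R,k,n}f$ be the difference of the boundary values. The norm of the error in $H^1(\mathbb R\pm i\delta)$ or $L^2(\mathbb R\pm i\delta)$ is the norm of $E^\pm_{n,\delta}$ in $H^1(\mathbb R)$ or $L^2(\mathbb R)$. **Theorem.** Let $\epsilon>0$ and $s>1+\epsilon$. There is a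 constant $C>0$, depending only on $\epsilon$, $s$ and $\beta$, such that for every continuous $f\in H^1(\mathbb R)$ with $F\in H^s(\mathbb T)$ and every $k\in\mathbb R$: the Cauchy integrals of $e^{-ikx}f$ and of $e^{-ikx}\mathcal R_nf$ ($n\ge1$) converge absolutely for $z\notin\mathbb R$ and their boundary values exist at every $x\in\mathbb R$; for all $n\ge1$, all $\delta\ge0$ and both signs, $$\|E^\pm_{n,\delta}\|_{H^1(\mathbb R)}\le(1+|k|)\,\|\mathcal R_nf-f\|_{H^1(\mathbb R)}\le C(1+|k|)\,n^{1+\epsilon-s}\|F\|_{H^s(\mathbb T)},$$ $$\|E^\pm_{n,\delta}\|_{L^2(\mathbb R)}\le\|\mathcal R_nf-f\|_{L^2(\mathbb R)}\le C\,n^{1+\epsilon-s}\|F\|_{H^s(\mathbb T)},$$ $$\sup_{x\in\mathbb R}|E^\pm_{n,\delta}(x)|\le\|E^\pm_{n,0}\|_{H^1(\mathbb R)},\qquad \sup_{x\in\mathbb R}|E^\pm_{n,\delta}(x)|\le C(1+|k|)\,n^{1+\epsilon-s}\|F\|_{H^s(\mathbb T)}.$$ Consequently, for fixed $k$, as $n\to\infty$,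 $\mathcal C_{\mathbb R,k,n}f\to\mathcal C_{\mathbb R,k}f$ uniformly on $\mathbb C\setminus\mathbb R$ and $\mathcal C^\pm_{\mathbb R,k,n}f\to\mathcal C^\pm_{\mathbb R,k}f$ uniformly on $\mathbb R$. -/

import Mathlib

noncomputable section

open MeasureTheory Filter Topology Complex FourierTransform
open scoped ENNReal

namespace OscCauchy

/-! ### Periodic Sobolev spaces -/

/-- The Fourier coefficient `(1 / 2π) ∫₀^{2π} e^{-ijθ} F(θ) dθ`. -/
def periodicCoeff (F : ℝ → ℂ) (j : ℤ) : ℂ :=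
  fourierCoeffOn Real.two_pi_pos F j

/-- The norm `(∑_j (1 + |j|)^{2s} |F̂_j|²)^{1/2}` of `H^s(𝕋)`, with values in `[0, ∞]`. -/
def periodicSobolevNorm (s : ℝ) (F : ℝ → ℂ) : ℝ≥0∞ :=
  (∑' j : ℤ, ENNReal.ofReal ((1 + |(j : ℝ)|) ^ (2 * s) * ‖periodicCoeff F j‖ ^ 2)) ^ (1 / 2 : ℝ)

/-- Membership of `F`, restricted to one period `[0, 2π]`, in `H^s(𝕋)`. -/
def MemPeriodicSobolev (s : ℝ) (F : ℝ → ℂ) : Prop :=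
  MemLp F 2 (volume.restrict (Set.Ioc 0 (2 * Real.pi))) ∧ periodicSobolevNorm s F < ∞

/-! ### Sobolev spaces on the line -/

/-- The `L²` Fourier transform in the normalization `𝓕 f(ξ) = ∫ e^{-iξx} f(x) dx`
(Mathlib's transform has the kernel `e^{-2πiξx}`). -/
def lineFourier (f : ℝ → ℂ) (hf : MemLp f 2 volume) (ξ : ℝ) : ℂ :=
  (𝓕 (hf.toLp f) : Lp ℂ 2 (volume : Measure ℝ)) (ξ / (2 * Real.pi))

open Classical in
/-- The norm `(∫ (1 + |ξ|)^{2s} |𝓕 f(ξ)|² dξ)^{1/2}` of `H^s(ℝ)`, with values in `[0, ∞]`;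
it is `∞` if `f` is not in `L²(ℝ)`. -/
def sobolevNorm (s : ℝ) (f : ℝ → ℂ) : ℝ≥0∞ :=
  if hf : MemLp f 2 volume then
    (∫⁻ ξ : ℝ, ENNReal.ofReal ((1 + |ξ|) ^ (2 * s) * ‖lineFourier f hf ξ‖ ^ 2)) ^ (1 / 2 : ℝ)
  else ∞

/-- Membership in `H^s(ℝ)`. -/
def MemSobolevLine (s : ℝ) (f : ℝ → ℂ) : Prop :=
  MemLp f 2 volume ∧ sobolevNorm s f < ∞

/-! ### Rational interpolation on the line -/

/-- The Möbius transformation `M_β(z) = (z - iβ) / (z + iβ)`. -/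
def moebius (β : ℝ) (z : ℂ) : ℂ := (z - I * β) / (z + I * β)

/-- The inverse Möbius transformation `M_β⁻¹(z) = (β / i) (z + 1) / (z - 1)`. -/
def moebiusInv (β : ℝ) (z : ℂ) : ℂ := β / I * ((z + 1) / (z - 1))

/-- `M_β⁻¹` is real-valued on the unit circle. -/
theorem moebiusInv_exp_im (β θ : ℝ) : (moebiusInv β (exp (θ * I))).im = 0 := by
  rw [← Complex.conj_eq_iff_im]
  have h : (starRingEnd ℂ) (exp (θ * I)) = (exp (θ * I))⁻¹ := by
    rw [← Complex.exp_conj, ← Complex.exp_neg]; simp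
  have hz : exp (θ * I) ≠ 0 := Complex.exp_ne_zero _
  unfold moebiusInv
  simp only [map_mul, map_div₀, map_add, map_sub, map_one, Complex.conj_ofReal, Complex.conj_I, h]
  generalize exp (θ * I) = z at *
  by_cases h1 : z = 1
  · subst h1; simp
  · have h2 : z - 1 ≠ 0 := sub_ne_zero.mpr h1
    have h3 : (1 : ℂ) - z ≠ 0 := sub_ne_zero.mpr (Ne.symm h1)
    have h4 : z⁻¹ - 1 ≠ 0 := by
      intro h; exact h1 (inv_eq_one.mp (sub_eq_zero.mp h))
    have hI := Complex.I_ne_zero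
    field_simp
    ring

/-- The change of variables `T(θ) = M_β⁻¹(e^{iθ})`, which is real
(see `moebiusInv_exp_im`). -/
def lineParam (β θ : ℝ) : ℝ := (moebiusInv β (exp (θ * I))).re

open Classical in
/-- The `2π`-periodic function `F(θ) = f(T(θ))`. Where `e^{iθ} = 1` the point `T(θ)` is the point at
infinity of the line, and `F` is given the value `f(∞) = 0`. -/
def pullback (β : ℝ) (f : ℝ → ℂ) (θ : ℝ) : ℂ :=
  if exp (θ * I) = 1 then 0 else f (lineParam β θ)

/-- The discrete Fourier coefficient `(1 / n) ∑_{l < n} e^{-ijθ_l} F(θ_l)`, `θ_l = 2πl/n`. -/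
def discreteCoeff (n : ℕ) (F : ℝ → ℂ) (j : ℤ) : ℂ :=
  (1 / n : ℂ) * ∑ l ∈ Finset.range n,
    exp (-(I * j * (2 * Real.pi * l / n : ℝ))) * F (2 * Real.pi * l / n)

/-- The rational interpolant `𝓡ₙ f(x) = ∑_{j = -n₋}^{n₊} F̃_j M_β(x)^j`, with `F̃_j` the discrete
Fourier coefficients of `F = f ∘ T`, `n₊ = ⌊n/2⌋` and `n₋ = ⌊(n-1)/2⌋`; that is, the trigonometric
interpolant of `F` at `T⁻¹(x)`, as `e^{i T⁻¹(x)} = M_β(x)`. -/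
def ratInterp (β : ℝ) (n : ℕ) (f : ℝ → ℂ) (x : ℝ) : ℂ :=
  ∑ j ∈ Finset.Icc (-(((n - 1) / 2 : ℕ) : ℤ)) ((n / 2 : ℕ) : ℤ),
    discreteCoeff n (pullback β f) j * moebius β x ^ j

/-! ### Oscillatory Cauchy integrals -/

/-- The integrand `e^{-ikx} f(x) / (x - z)`. -/
def cauchyIntegrand (k : ℝ) (f : ℝ → ℂ) (z : ℂ) (x : ℝ) : ℂ :=
  exp (-(I * k * x)) * f x / (x - z)

/-- The oscillatory Cauchy integral `(1 / 2πi) ∫ e^{-ikx} f(x) / (x - z) dx`, for `z ∉ ℝ`. -/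
def oscCauchy (k : ℝ) (f : ℝ → ℂ) (z : ℂ) : ℂ :=
  1 / (2 * Real.pi * I) * ∫ x : ℝ, cauchyIntegrand k f z x

/-- The approximation `𝓒_{ℝ,k,n} f = 𝓒_{ℝ,k} 𝓡ₙ f`. -/
def oscCauchyApprox (β k : ℝ) (n : ℕ) (f : ℝ → ℂ) (z : ℂ) : ℂ :=
  oscCauchy k (ratInterp β n f) z

/-- The boundary values `Φ^±(x) = lim_{ε → 0+} Φ(x ± iε)` of a function `Φ` on `ℂ \ ℝ`. -/
def boundaryValue (σ : ℤˣ) (Φ : ℂ → ℂ) (x : ℝ) : ℂ :=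
  limUnder (𝓝[>] (0 : ℝ)) fun ε : ℝ => Φ (x + ((σ : ℤ) : ℂ) * ε * I)

/-- The restriction of `Φ` to the line `ℝ ± iδ` as a function of `x ∈ ℝ`; for `δ = 0` it is the
boundary value `Φ^±`. -/
def lineTrace (σ : ℤˣ) (δ : ℝ) (Φ : ℂ → ℂ) (x : ℝ) : ℂ :=
  if δ = 0 then boundaryValue σ Φ x else Φ (x + ((σ : ℤ) : ℂ) * δ * I)

/-- The error `𝓒_{ℝ,k} f - 𝓒_{ℝ,k,n} f` on the line `ℝ ± iδ`. -/
def lineError (β k : ℝ) (n : ℕ) (f : ℝ → ℂ) (σ : ℤˣ) (δ : ℝ) (x : ℝ) : ℂ :=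
  lineTrace σ δ (oscCauchy k f) x - lineTrace σ δ (oscCauchyApprox β k n f) x

end OscCauchy

end

/-!
On the line `ℝ ± iδ` the oscillatory Cauchy integral is, on the Fourier side, multiplication of the
shifted transform `𝓕 f(· + k/2π)` by a function of modulus at most one, which for `δ → 0` becomes
the indicator of a half line. It is therefore a contraction of `L²`, and a bounded map of `H¹` with
constant `1 + |k|`, the price of the shift, so that the error of the method is controlled by the
interpolation error `𝓡ₙ f - f`.

With `f = ∑ aⱼ M ^ j`, interpolation replaces `M ^ j` by `M ^ j'`, where `j'` is the representative
of `j` modulo `n` in the window of `𝓡ₙ`. The `L²(ℝ)` norm of `M ^ j' - M ^ j` is of order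
`√|j' - j|`, while the derivatives of the powers of `M` reduce to their orthogonality with respect
to the density `2β / (x² + β²)`. Splitting the sum into fibres modulo `n` and applying the
Cauchy–Schwarz inequality on each gives the rate `n ^ (1 - s)`. Since `𝓡₁ f = 0`, the case `n = 1`
shows that `f` lies in `H¹(ℝ)` as soon as it vanishes at infinity.
-/

noncomputable section

open MeasureTheory Filter Topology Complex FourierTransform SchwartzMap InnerProductSpace
open scoped ENNReal

namespace OscCauchy

section Plancherel

variable {V E : Type*} [NormedAddCommGroup V] [InnerProductSpace ℝ V] [FiniteDimensional ℝ V]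
  [MeasurableSpace V] [BorelSpace V] [NormedAddCommGroup E] [InnerProductSpace ℂ E] {h w : V → E}

theorem continuous_fourierInv_of_integrable (hw : Integrable w) : Continuous (𝓕⁻ w) :=
  VectorFourier.fourierIntegral_continuous Real.continuous_fourierChar
    (L := -innerₗ V) continuous_inner.neg hw

variable [CompleteSpace E]

/-- The Plancherel transform of a square integrable function, in Mathlib's normalization (kernel
`e^{-2πi⟪t, x⟫}`), as a function on `V`; only its class modulo null sets is meaningful. -/
def fourierL2 {h : V → E} (hh : MemLp h 2) : V → E :=
  (𝓕 (hh.toLp h) : Lp E 2 (volume : Measure V))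

theorem memLp_fourierL2 (hh : MemLp h 2) : MemLp (fourierL2 hh) 2 :=
  Lp.memLp _

theorem eLpNorm_fourierL2 (hh : MemLp h 2) : eLpNorm (fourierL2 hh) 2 = eLpNorm h 2 := by
  rw [← eLpNorm_congr_ae hh.coeFn_toLp, ← Lp.enorm_def, fourierL2, ← Lp.enorm_def,
    enorm_eq_iff_norm_eq, Lp.norm_fourier_eq]

theorem fourierL2_neg (hh : MemLp h 2) : fourierL2 hh.neg =ᵐ[volume] -fourierL2 hh := by
  rw [fourierL2, MemLp.toLp_neg, FourierTransform.fourier_neg]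
  exact Lp.coeFn_neg _

theorem fourierL2_sub {g : V → E} (hg : MemLp g 2) (hh : MemLp h 2) :
    fourierL2 (hg.sub hh) =ᵐ[volume] fourierL2 hg - fourierL2 hh := by
  rw [fourierL2, MemLp.toLp_sub hg hh, sub_eq_add_neg, FourierTransform.fourier_add,
    FourierTransform.fourier_neg, ← sub_eq_add_neg]
  exact Lp.coeFn_sub _ _

theorem ae_eq_of_integral_schwartz_smul_eq {u v : V → E} (hu : LocallyIntegrable u)
    (hv : LocallyIntegrable v) (huv : ∀ φ : 𝓢(V, ℂ), ∫ x, φ x • u x = ∫ x, φ x • v x) :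
    u =ᵐ[volume] v := by
  refine ae_eq_of_integral_contDiff_smul_eq hu hv fun g hg hc => ?_
  have hc' : HasCompactSupport (Complex.ofRealCLM ∘ g) := hc.comp_left rfl
  have hg' : ContDiff ℝ ((⊤ : ℕ∞) : WithTop ℕ∞) (Complex.ofRealCLM ∘ g) := by fun_prop
  simpa using! huv (hc'.toSchwartzMap hg')

theorem integral_fourierInv_smul_eq {u : V → ℂ} (hu : Integrable u) (hw : Integrable w) :
    ∫ x, 𝓕⁻ u x • w x = ∫ x, u x • 𝓕⁻ w x := by
  have h_flip := VectorFourier.integral_fourierIntegral_smul_eq_flip (L := -innerₗ V)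
    Real.continuous_fourierChar continuous_inner.neg hu hw
  simpa [Real.fourierInv_eq, VectorFourier.fourierIntegral, real_inner_comm] using h_flip

theorem coeFn_fourierInv_toLp (hw : Integrable w) (hw2 : MemLp w 2) :
    (𝓕⁻ (hw2.toLp w) : Lp E 2 (volume : Measure V)) =ᵐ[volume] 𝓕⁻ w := by
  refine ae_eq_of_integral_schwartz_smul_eq ((Lp.memLp _).locallyIntegrable one_le_two)
    (continuous_fourierInv_of_integrable hw).locallyIntegrable fun φ => ?_
  have h_dist := congrArg (fun T => T φ) (Lp.fourierInv_toTemperedDistribution_eq (hw2.toLp w))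
  simp only [TemperedDistribution.fourierInv_apply, Lp.toTemperedDistribution_apply] at h_dist
  rw [← h_dist, ← integral_fourierInv_smul_eq φ.integrable hw]
  refine integral_congr_ae ?_
  filter_upwards [hw2.coeFn_toLp] with x hx
  rw [hx, SchwartzMap.fourierInv_coe]

theorem memLp_fourierInv (hw : Integrable w) (hw2 : MemLp w 2) : MemLp (𝓕⁻ w) 2 :=
  (memLp_congr_ae (coeFn_fourierInv_toLp hw hw2)).mp (Lp.memLp _)

theorem toLp_fourierInv (hw : Integrable w) (hw2 : MemLp w 2) :
    (memLp_fourierInv hw hw2).toLp (𝓕⁻ w) = 𝓕⁻ (hw2.toLp w) :=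
  Lp.ext ((memLp_fourierInv hw hw2).coeFn_toLp.trans (coeFn_fourierInv_toLp hw hw2).symm)

theorem fourierL2_fourierInv (hw : Integrable w) (hw2 : MemLp w 2) :
    fourierL2 (memLp_fourierInv hw hw2) =ᵐ[volume] w := by
  rw [fourierL2, toLp_fourierInv hw hw2, FourierTransform.fourier_fourierInv_eq]
  exact hw2.coeFn_toLp

theorem eLpNorm_fourierInv (hw : Integrable w) (hw2 : MemLp w 2) :
    eLpNorm (𝓕⁻ w) 2 = eLpNorm w 2 := by
  rw [← eLpNorm_fourierL2 (memLp_fourierInv hw hw2),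
    eLpNorm_congr_ae (fourierL2_fourierInv hw hw2)]

theorem fourierInv_fourierL2_eq (hc : Continuous h) (hh : MemLp h 2)
    (hv : Integrable (fourierL2 hh)) : 𝓕⁻ (fourierL2 hh) = h := by
  refine (Continuous.ae_eq_iff_eq volume (continuous_fourierInv_of_integrable hv) hc).mp ?_
  have h_inv := coeFn_fourierInv_toLp hv (memLp_fourierL2 hh)
  have h_toLp : (memLp_fourierL2 hh).toLp _ = 𝓕 (hh.toLp h) := Lp.toLp_coeFn _ _
  rw [h_toLp, FourierTransform.fourierInv_fourier_eq] at h_inv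
  exact h_inv.symm.trans hh.coeFn_toLp

theorem integral_inner_fourierInv (hw : Integrable w) (hw2 : MemLp w 2) (hh : MemLp h 2) :
    ∫ x, ⟪𝓕⁻ w x, h x⟫_ℂ = ∫ t, ⟪w t, fourierL2 hh t⟫_ℂ := by
  have h_toLp : ∀ {g : V → E} (hg : MemLp g 2), (fun x => ⟪g x, h x⟫_ℂ) =ᵐ[volume]
      fun x => ⟪hg.toLp g x, hh.toLp h x⟫_ℂ := fun hg => by
    filter_upwards [hg.coeFn_toLp, hh.coeFn_toLp] with x hgx hhx
    rw [hgx, hhx]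
  have h_plancherel : ⟪𝓕⁻ (hw2.toLp w), hh.toLp h⟫_ℂ = ⟪hw2.toLp w, 𝓕 (hh.toLp h)⟫_ℂ := by
    rw [← Lp.inner_fourier_eq, FourierTransform.fourier_fourierInv_eq]
  rw [integral_congr_ae (h_toLp (memLp_fourierInv hw hw2)), toLp_fourierInv hw hw2, ← L2.inner_def,
    h_plancherel, L2.inner_def]
  refine integral_congr_ae ?_
  filter_upwards [hw2.coeFn_toLp] with t ht
  rw [ht, fourierL2]

end Plancherel

section Derivative

open LineDeriv

variable {E : Type*} [NormedAddCommGroup E] [InnerProductSpace ℂ E] [CompleteSpace E]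
  {g g' : ℝ → E}

theorem toTemperedDistribution_toLp_deriv (hg : MemLp g 2) (hg' : MemLp g' 2)
    (hd : ∀ x, HasDerivAt g (g' x) x) :
    (hg'.toLp g' : 𝓢'(ℝ, E)) = ∂_{(1 : ℝ)} (hg.toLp g : 𝓢'(ℝ, E)) := by
  ext φ
  have h_int : ∀ (χ : 𝓢(ℝ, ℂ)) {u : ℝ → E}, MemLp u 2 → Integrable fun x => χ x • u x :=
    fun χ u hu => memLp_one_iff_integrable.mp (hu.smul (χ.memLp 2 volume))
  have h_toLp : ∀ (χ : 𝓢(ℝ, ℂ)) {u : ℝ → E} (hu : MemLp u 2),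
      ∫ x, χ x • hu.toLp u x = ∫ x, χ x • u x := fun χ u hu => by
    refine integral_congr_ae ?_
    filter_upwards [hu.coeFn_toLp] with x hx
    rw [hx]
  have h_deriv : ∀ x, HasDerivAt φ ((∂_{(1 : ℝ)} φ) x) x := fun x => by
    rw [SchwartzMap.lineDerivOp_apply_eq_fderiv, fderiv_apply_one_eq_deriv]
    exact φ.hasDerivAt x
  have h_parts := integral_bilinear_hasDerivAt_right_eq_neg_left_of_integrable
    (L := ContinuousLinearMap.lsmul ℝ ℂ) (fun x _ => h_deriv x) (fun x _ => hd x)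
    (h_int φ hg') (h_int _ hg) (h_int φ hg)
  simpa [h_toLp, integral_neg] using h_parts

theorem fourierL2_deriv (hg : MemLp g 2) (hg' : MemLp g' 2) (hd : ∀ x, HasDerivAt g (g' x) x) :
    fourierL2 hg' =ᵐ[volume] fun t : ℝ => (2 * Real.pi * I * t) • fourierL2 hg t := by
  have h_loc : LocallyIntegrable (fourierL2 hg) :=
    (memLp_fourierL2 hg).locallyIntegrable one_le_two
  refine ae_eq_of_integral_schwartz_smul_eq ((memLp_fourierL2 hg').locallyIntegrable one_le_two)
    (h_loc.continuous_smul (by fun_prop)) fun φ => ?_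
  have h_growth : (fun t : ℝ => (t : ℂ)).HasTemperateGrowth := by fun_prop
  have h_dist : 𝓕 (hg'.toLp g' : 𝓢'(ℝ, E)) φ = 𝓕 (∂_{(1 : ℝ)} (hg.toLp g : 𝓢'(ℝ, E))) φ := by
    rw [toTemperedDistribution_toLp_deriv hg hg' hd]
  rw [TemperedDistribution.fourier_lineDerivOp_eq, Lp.fourier_toTemperedDistribution_eq,
    Lp.fourier_toTemperedDistribution_eq, Lp.toTemperedDistribution_apply] at h_dist
  calc ∫ t, φ t • fourierL2 hg' t
    _ = (2 * Real.pi * I) • ∫ t : ℝ, ((t : ℂ) * φ t) • fourierL2 hg t := by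
      simpa [SchwartzMap.smulLeftCLM_apply_apply h_growth] using! h_dist
    _ = ∫ t, φ t • (2 * Real.pi * I * t) • fourierL2 hg t := by
      rw [← integral_smul]
      exact integral_congr_ae (.of_forall fun t => by simp only [smul_smul]; ring_nf)

end Derivative

section NormBounds

variable {α E : Type*} [MeasurableSpace α] {μ : Measure α} [NormedAddCommGroup E]

theorem eLpNorm_two_le_of_norm_sq_le {g : α → E} {G : α → ℝ} (hG : Integrable G μ)
    (hg : ∀ᵐ x ∂μ, ‖g x‖ ^ 2 ≤ G x) : eLpNorm g 2 μ ≤ ENNReal.ofReal √(∫ x, G x ∂μ) := by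
  have hG0 : 0 ≤ᵐ[μ] G := hg.mono fun x hx => (sq_nonneg _).trans hx
  have h_sq : ∫⁻ x, ‖g x‖ₑ ^ (2 : ℝ) ∂μ ≤ ENNReal.ofReal (∫ x, G x ∂μ) := by
    rw [ofReal_integral_eq_lintegral_ofReal hG hG0]
    refine lintegral_mono_ae (hg.mono fun x hx => ?_)
    rw [ENNReal.rpow_ofNat, ← ofReal_norm, ← ENNReal.ofReal_pow (norm_nonneg _)]
    exact ENNReal.ofReal_le_ofReal hx
  rw [eLpNorm_eq_lintegral_rpow_enorm_toReal two_ne_zero ENNReal.ofNat_ne_top, Real.sqrt_eq_rpow,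
    ← ENNReal.ofReal_rpow_of_nonneg (integral_nonneg_of_ae hG0) (by positivity)]
  exact ENNReal.rpow_le_rpow h_sq (by positivity)

theorem memLp_two_of_integrable_of_bound {g : α → E} (hg : Integrable g μ) {C : ℝ}
    (hC : ∀ᵐ x ∂μ, ‖g x‖ ≤ C) : MemLp g 2 μ := by
  refine ⟨hg.1, (eLpNorm_two_le_of_norm_sq_le (hg.norm.const_mul C) ?_).trans_lt
    ENNReal.ofReal_lt_top⟩
  filter_upwards [hC] with x hx
  rw [sq]
  gcongr

end NormBounds

section Rescaling

variable {E : Type*} [NormedAddCommGroup E] {c : ℝ} {u : ℝ → E}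

theorem map_div_const_volume (hc : c ≠ 0) :
    Measure.map (fun ξ : ℝ => ξ / c) volume = ENNReal.ofReal |c| • (volume : Measure ℝ) := by
  simpa [div_eq_mul_inv] using Real.map_volume_mul_right (inv_ne_zero hc)

theorem quasiMeasurePreserving_div_const (hc : c ≠ 0) :
    Measure.QuasiMeasurePreserving (fun ξ : ℝ => ξ / c) volume volume :=
  ⟨by fun_prop, by rw [map_div_const_volume hc]; exact Measure.smul_absolutelyContinuous⟩

theorem eLpNorm_comp_div_const (hc : c ≠ 0) (hu : AEStronglyMeasurable u) {p : ℝ≥0∞}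
    (hp : p ≠ ∞) :
    eLpNorm (fun ξ => u (ξ / c)) p =
      ENNReal.ofReal |c| ^ (1 / p).toReal * eLpNorm u p := by
  have hu_map : AEStronglyMeasurable u (Measure.map (fun ξ : ℝ => ξ / c) volume) := by
    rw [map_div_const_volume hc]
    exact hu.smul_measure _
  have h_map := eLpNorm_map_measure (p := p) hu_map (by fun_prop)
  rwa [map_div_const_volume hc, eLpNorm_smul_measure_of_ne_top hp, eq_comm] at h_map

end Rescaling

section Sobolev

variable {s : ℝ} {g h u v : ℝ → ℂ}

/-- The function `ξ ↦ (1 + |ξ|)^s u(ξ / 2π)`, whose `L²` norm is the `H^s` norm of `h` when `u` is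
`fourierL2` of `h`; the rescaling passes from Mathlib's Fourier kernel `e^{-2πitx}` to
`e^{-iξx}`. -/
def sobolevWeight (s : ℝ) (u : ℝ → ℂ) (ξ : ℝ) : ℂ :=
  ((1 + |ξ|) ^ s : ℝ) * u (ξ / (2 * Real.pi))

theorem sobolevWeight_fourierL2 (hh : MemLp h 2) (ξ : ℝ) :
    sobolevWeight s (fourierL2 hh) ξ = ((1 + |ξ|) ^ s : ℝ) * lineFourier h hh ξ :=
  rfl

theorem quasiMeasurePreserving_div_two_pi :
    Measure.QuasiMeasurePreserving (fun ξ : ℝ => ξ / (2 * Real.pi)) volume volume :=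
  quasiMeasurePreserving_div_const Real.two_pi_pos.ne'

theorem sobolevWeight_congr (huv : u =ᵐ[volume] v) :
    sobolevWeight s u =ᵐ[volume] sobolevWeight s v := by
  filter_upwards [quasiMeasurePreserving_div_two_pi.ae_eq_comp huv] with ξ hξ
  exact congrArg _ hξ

theorem continuous_one_add_abs_rpow (s : ℝ) : Continuous fun ξ : ℝ => (1 + |ξ|) ^ s :=
  Continuous.rpow_const (by fun_prop) fun ξ => .inl (by positivity)

theorem aestronglyMeasurable_sobolevWeight (hu : AEStronglyMeasurable u) :
    AEStronglyMeasurable (sobolevWeight s u) :=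
  (continuous_ofReal.comp (continuous_one_add_abs_rpow s)).aestronglyMeasurable.mul
    (hu.comp_quasiMeasurePreserving quasiMeasurePreserving_div_two_pi)

theorem sobolevNorm_eq (s : ℝ) (hh : MemLp h 2) :
    sobolevNorm s h = eLpNorm (sobolevWeight s (fourierL2 hh)) 2 := by
  rw [sobolevNorm, dif_pos hh, eLpNorm_eq_lintegral_rpow_enorm_toReal two_ne_zero
    ENNReal.ofNat_ne_top, ENNReal.toReal_ofNat]
  congr 1
  refine lintegral_congr fun ξ => ?_
  have h_base : 0 ≤ 1 + |ξ| := by positivity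
  rw [ENNReal.rpow_ofNat, ← ofReal_norm, ← ENNReal.ofReal_pow (norm_nonneg _),
    sobolevWeight_fourierL2, norm_mul, mul_pow, Complex.norm_real,
    Real.norm_of_nonneg (by positivity), mul_comm 2 s, Real.rpow_mul h_base, Real.rpow_ofNat]

theorem sobolevNorm_neg (s : ℝ) (h : ℝ → ℂ) : sobolevNorm s (-h) = sobolevNorm s h := by
  by_cases hh : MemLp h 2
  · rw [sobolevNorm_eq s hh, sobolevNorm_eq s hh.neg]
    refine eLpNorm_congr_norm_ae ?_
    filter_upwards [sobolevWeight_congr (s := s) (fourierL2_neg hh)] with ξ hξ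
    rw [hξ]
    simp [sobolevWeight]
  · rw [sobolevNorm, dif_neg fun hn => hh (by simpa using hn.neg), sobolevNorm, dif_neg hh]

theorem sobolevNorm_sub_le (hg : MemLp g 2) (hh : MemLp h 2) :
    sobolevNorm s (g - h) ≤ sobolevNorm s g + sobolevNorm s h := by
  rw [sobolevNorm_eq s hg, sobolevNorm_eq s hh, sobolevNorm_eq s (hg.sub hh)]
  have h_sub : sobolevWeight s (fourierL2 (hg.sub hh)) =ᵐ[volume]
      sobolevWeight s (fourierL2 hg) - sobolevWeight s (fourierL2 hh) := by
    filter_upwards [sobolevWeight_congr (s := s) (fourierL2_sub hg hh)] with ξ hξ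
    exact hξ.trans (mul_sub _ _ _)
  rw [eLpNorm_congr_ae h_sub]
  exact eLpNorm_sub_le (aestronglyMeasurable_sobolevWeight (memLp_fourierL2 hg).1)
    (aestronglyMeasurable_sobolevWeight (memLp_fourierL2 hh).1) one_le_two

theorem MemSobolevLine.neg (hh : MemSobolevLine s h) : MemSobolevLine s (-h) :=
  ⟨hh.1.neg, (sobolevNorm_neg s h).trans_lt hh.2⟩

theorem MemSobolevLine.sub (hg : MemSobolevLine s g) (hh : MemSobolevLine s h) :
    MemSobolevLine s (g - h) :=
  ⟨hg.1.sub hh.1, (sobolevNorm_sub_le hg.1 hh.1).trans_lt (ENNReal.add_lt_top.mpr ⟨hg.2, hh.2⟩)⟩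

theorem eLpNorm_one_add_abs_inv_le :
    eLpNorm (fun ξ : ℝ => ((1 + |ξ| : ℝ) : ℂ)⁻¹) 2 ≤ ENNReal.ofReal √Real.pi := by
  rw [← integral_univ_inv_one_add_sq]
  refine eLpNorm_two_le_of_norm_sq_le integrable_inv_one_add_sq (.of_forall fun ξ => ?_)
  rw [norm_inv, Complex.norm_real, Real.norm_of_nonneg (by positivity), inv_pow]
  refine inv_anti₀ (by positivity) ?_
  nlinarith [abs_nonneg ξ, sq_abs ξ]

theorem eLpNorm_one_le_sobolevWeight (hu : AEStronglyMeasurable u) :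
    eLpNorm u 1 ≤ eLpNorm (sobolevWeight 1 u) 2 := by
  have h_split : (fun ξ : ℝ => u (ξ / (2 * Real.pi))) =
      (fun ξ : ℝ => ((1 + |ξ| : ℝ) : ℂ)⁻¹) • sobolevWeight 1 u := by
    ext ξ
    have h_pos : ((1 + |ξ| : ℝ) : ℂ) ≠ 0 := by exact_mod_cast (by positivity : 1 + |ξ| ≠ 0)
    rw [Pi.smul_apply', smul_eq_mul, sobolevWeight, Real.rpow_one, inv_mul_cancel_left₀ h_pos]
  have h_holder : ENNReal.ofReal (2 * Real.pi) * eLpNorm u 1 ≤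
      ENNReal.ofReal √Real.pi * eLpNorm (sobolevWeight 1 u) 2 := by
    have h_scale := eLpNorm_comp_div_const Real.two_pi_pos.ne' hu ENNReal.one_ne_top
    rw [h_split, div_one, ENNReal.toReal_one, ENNReal.rpow_one, abs_of_pos Real.two_pi_pos]
      at h_scale
    rw [← h_scale]
    refine (eLpNorm_smul_le_mul_eLpNorm (p := 2) (q := 2)
      (aestronglyMeasurable_sobolevWeight hu) (by fun_prop)).trans ?_
    gcongr
    exact eLpNorm_one_add_abs_inv_le
  have h_const : √Real.pi ≤ 2 * Real.pi := by
    rw [Real.sqrt_le_left (by positivity)]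
    nlinarith [Real.pi_gt_three]
  refine (ENNReal.mul_le_mul_iff_right (ENNReal.ofReal_pos.mpr Real.two_pi_pos).ne'
    ENNReal.ofReal_ne_top).mp (h_holder.trans ?_)
  gcongr

theorem MemSobolevLine.integrable_fourierL2 (hh : MemSobolevLine 1 h) :
    Integrable (fourierL2 hh.1) := by
  have h_meas := (memLp_fourierL2 hh.1).1
  refine memLp_one_iff_integrable.mp ⟨h_meas, (eLpNorm_one_le_sobolevWeight h_meas).trans_lt ?_⟩
  rw [← sobolevNorm_eq]
  exact hh.2

theorem aestronglyMeasurable_lineFourier (hh : MemLp h 2) :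
    AEStronglyMeasurable (lineFourier h hh) :=
  (memLp_fourierL2 hh).1.comp_quasiMeasurePreserving quasiMeasurePreserving_div_two_pi

theorem eLpNorm_lineFourier_le (hh : MemLp h 2) :
    eLpNorm (lineFourier h hh) 2 ≤ ENNReal.ofReal (2 * Real.pi) * eLpNorm h 2 := by
  have h_scale := eLpNorm_comp_div_const (p := 2) Real.two_pi_pos.ne' (memLp_fourierL2 hh).1
    ENNReal.ofNat_ne_top
  rw [eLpNorm_fourierL2, abs_of_pos Real.two_pi_pos] at h_scale
  refine h_scale.trans_le (mul_le_mul_left ?_ _)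
  refine (ENNReal.rpow_le_rpow_of_exponent_le (z := 1) ?_ ?_).trans_eq (ENNReal.rpow_one _)
  · exact ENNReal.one_le_ofReal.mpr (by linarith [Real.pi_gt_three])
  · norm_num

theorem lineFourier_deriv {g' : ℝ → ℂ} (hg : MemLp g 2) (hg' : MemLp g' 2)
    (hd : ∀ x, HasDerivAt g (g' x) x) :
    lineFourier g' hg' =ᵐ[volume] fun ξ => I * ξ * lineFourier g hg ξ := by
  filter_upwards [quasiMeasurePreserving_div_two_pi.ae_eq_comp (fourierL2_deriv hg hg' hd)]
    with ξ hξ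
  have h_factor : (2 * Real.pi * I * ((ξ / (2 * Real.pi) : ℝ) : ℂ) : ℂ) = I * ξ := by
    push_cast
    field_simp [Real.pi_ne_zero]
  simp only [Function.comp_apply, h_factor] at hξ
  exact hξ

theorem sobolevNorm_one_le_of_hasDerivAt {g' : ℝ → ℂ} (hg : MemLp g 2) (hg' : MemLp g' 2)
    (hd : ∀ x, HasDerivAt g (g' x) x) :
    sobolevNorm 1 g ≤ ENNReal.ofReal (2 * Real.pi) * (eLpNorm g 2 + eLpNorm g' 2) := by
  have h_split : sobolevWeight 1 (fourierL2 hg) =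
      lineFourier g hg + fun ξ => ((|ξ| : ℝ) : ℂ) * lineFourier g hg ξ := by
    ext ξ
    rw [sobolevWeight_fourierL2, Real.rpow_one, Pi.add_apply, ofReal_add, ofReal_one, add_mul,
      one_mul]
  have h_deriv : eLpNorm (fun ξ => ((|ξ| : ℝ) : ℂ) * lineFourier g hg ξ) 2 =
      eLpNorm (lineFourier g' hg') 2 := by
    refine eLpNorm_congr_norm_ae ?_
    filter_upwards [lineFourier_deriv hg hg' hd] with ξ hξ
    rw [hξ, norm_mul, norm_mul, norm_mul, norm_I, one_mul, norm_real, norm_real,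
      Real.norm_eq_abs, Real.norm_eq_abs, abs_abs]
  have h_cont : Continuous fun ξ : ℝ => ((|ξ| : ℝ) : ℂ) := by fun_prop
  have h_meas := aestronglyMeasurable_lineFourier hg
  have h_le : sobolevNorm 1 g ≤ eLpNorm (lineFourier g hg) 2 + eLpNorm (lineFourier g' hg') 2 := by
    rw [sobolevNorm_eq 1 hg, h_split, ← h_deriv]
    exact eLpNorm_add_le h_meas (h_cont.aestronglyMeasurable.mul h_meas) one_le_two
  refine h_le.trans ?_
  rw [mul_add]
  exact add_le_add (eLpNorm_lineFourier_le hg) (eLpNorm_lineFourier_le hg')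

theorem sobolevNorm_le_of_tendsto_eLpNorm {ι : Type*} {l : Filter ι} [l.NeBot]
    [l.IsCountablyGenerated] {G : ι → ℝ → ℂ} {B : ℝ≥0∞} (hG : ∀ i, MemLp (G i) 2)
    (hg : MemLp g 2) (hlim : Tendsto (fun i => eLpNorm (G i - g) 2) l (𝓝 0))
    (hB : ∀ i, sobolevNorm s (G i) ≤ B) : sobolevNorm s g ≤ B := by
  have h_fourier : Tendsto (fun i => eLpNorm (fourierL2 (hG i) - fourierL2 hg) 2) l (𝓝 0) := by
    refine hlim.congr fun i => ?_
    rw [← eLpNorm_fourierL2 ((hG i).sub hg), eLpNorm_congr_ae (fourierL2_sub (hG i) hg)]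
  obtain ⟨ns, -, hns⟩ := (tendstoInMeasure_of_tendsto_eLpNorm two_ne_zero
    (fun i => (memLp_fourierL2 (hG i)).1) (memLp_fourierL2 hg).1 h_fourier).exists_seq_tendsto_ae'
  have h_ae : ∀ᵐ ξ, Tendsto (fun i => sobolevWeight s (fourierL2 (hG (ns i))) ξ) atTop
      (𝓝 (sobolevWeight s (fourierL2 hg) ξ)) := by
    filter_upwards [quasiMeasurePreserving_div_two_pi.ae hns] with ξ hξ
    exact hξ.const_mul _
  rw [sobolevNorm_eq s hg]
  exact Lp.eLpNorm_le_of_ae_tendsto (.of_forall fun i => sobolevNorm_eq s (hG (ns i)) ▸ hB (ns i))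
    (fun i => aestronglyMeasurable_sobolevWeight (memLp_fourierL2 (hG (ns i))).1) h_ae

end Sobolev

section CauchyMultiplier

variable {k δ : ℝ} {σ : ℤˣ}

theorem abs_units_cast (σ : ℤˣ) : |((σ : ℤ) : ℝ)| = 1 := by
  rcases Int.units_eq_one_or σ with rfl | rfl <;> simp

theorem units_cast_ne_zero (σ : ℤˣ) : ((σ : ℤ) : ℝ) ≠ 0 := by
  simp

/-- The Fourier multiplier `± 1_{±t > 0} e^{-2πδ|t|}` which maps a function on the line to its
Cauchy integral on the line `ℝ ± iδ`. -/
def cauchyMultiplier (σ : ℤˣ) (δ t : ℝ) : ℝ :=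
  (σ : ℤ) * (Set.Ioi 0).indicator (fun r => Real.exp (-(2 * Real.pi * δ * r))) ((σ : ℤ) * t)

theorem norm_cauchyMultiplier (σ : ℤˣ) (δ t : ℝ) : ‖cauchyMultiplier σ δ t‖ =
    (Set.Ioi 0).indicator (fun r => Real.exp (-(2 * Real.pi * δ * r))) ((σ : ℤ) * t) := by
  rw [cauchyMultiplier, norm_mul, Real.norm_eq_abs, abs_units_cast, one_mul,
    Real.norm_of_nonneg (Set.indicator_nonneg (fun r _ => (Real.exp_pos _).le) _)]

theorem norm_cauchyMultiplier_antitone (σ : ℤˣ) (t : ℝ) :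
    Antitone fun δ => ‖cauchyMultiplier σ δ t‖ := by
  intro δ δ' hδ
  simp only [norm_cauchyMultiplier]
  refine Set.indicator_le_indicator' fun hr => ?_
  have hr : 0 < ((σ : ℤ) : ℝ) * t := hr
  gcongr

theorem norm_cauchyMultiplier_le_one (hδ : 0 ≤ δ) (t : ℝ) : ‖cauchyMultiplier σ δ t‖ ≤ 1 := by
  refine (norm_cauchyMultiplier_antitone σ t hδ).trans ?_
  simp only [norm_cauchyMultiplier]
  exact Set.indicator_apply_le' (fun _ => by simp) fun _ => zero_le_one

theorem measurable_cauchyMultiplier (σ : ℤˣ) (δ : ℝ) : Measurable (cauchyMultiplier σ δ) := by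
  have h_meas : Measurable ((Set.Ioi 0).indicator fun r => Real.exp (-(2 * Real.pi * δ * r))) :=
    Measurable.indicator (by fun_prop) measurableSet_Ioi
  exact (h_meas.comp (measurable_const_mul _)).const_mul _

theorem integrable_cauchyMultiplier (σ : ℤˣ) (hδ : 0 < δ) : Integrable (cauchyMultiplier σ δ) := by
  have h_exp : IntegrableOn (fun r => Real.exp (-(2 * Real.pi * δ * r))) (Set.Ioi 0) := by
    simpa using exp_neg_integrableOn_Ioi 0 (by positivity : 0 < 2 * Real.pi * δ)
  exact ((h_exp.integrable_indicator measurableSet_Ioi).comp_mul_left'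
    (units_cast_ne_zero σ)).const_mul _

theorem continuous_cauchyMultiplier_left (σ : ℤˣ) (t : ℝ) :
    Continuous fun δ => cauchyMultiplier σ δ t := by
  by_cases ht : ((σ : ℤ) : ℝ) * t ∈ Set.Ioi 0
  · simp only [cauchyMultiplier, Set.indicator_of_mem ht]
    fun_prop
  · simp only [cauchyMultiplier, Set.indicator_of_notMem ht]
    fun_prop

theorem fourierInv_cauchyMultiplier (σ : ℤˣ) (hδ : 0 < δ) (u : ℝ) :
    𝓕⁻ (fun t => (cauchyMultiplier σ δ t : ℂ)) u =
      -(1 / (2 * Real.pi * I * (u + ((σ : ℤ) : ℂ) * δ * I))) := by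
  have h_sq : ((σ : ℤ) : ℂ) * ((σ : ℤ) : ℂ) = 1 := by
    rcases Int.units_eq_one_or σ with rfl | rfl <;> simp
  let a : ℂ := 2 * Real.pi * (I * u * ((σ : ℤ) : ℂ) - δ)
  have ha : a.re < 0 := by
    have h_re : a.re = -(2 * Real.pi * δ) := by simp [a]
    rw [h_re]
    exact neg_lt_zero.mpr (by positivity)
  have ha0 : a ≠ 0 := fun h => by simp [h] at ha
  have h_reflect : 𝓕⁻ (fun t => (cauchyMultiplier σ δ t : ℂ)) u =
      ∫ t : ℝ, ((σ : ℤ) : ℂ) * (Set.Ioi 0).indicator (fun r : ℝ => exp (a * r)) ((σ : ℤ) * t) := by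
    rw [Real.fourierInv_eq']
    refine integral_congr_ae (.of_forall fun t => ?_)
    by_cases ht : ((σ : ℤ) : ℝ) * t ∈ Set.Ioi 0
    · simp only [cauchyMultiplier, Set.indicator_of_mem ht, smul_eq_mul]
      push_cast
      rw [mul_left_comm, ← Complex.exp_add]
      congr 2
      simp only [a, RCLike.inner_apply, conj_trivial]
      push_cast
      linear_combination (-2 * Real.pi * t * u * I) * h_sq
    · simp [cauchyMultiplier, Set.indicator_of_notMem ht]
  rw [h_reflect, integral_const_mul, Measure.integral_comp_mul_left _ ((σ : ℤ) : ℝ), abs_inv,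
    abs_units_cast, inv_one, one_smul, integral_indicator measurableSet_Ioi,
    integral_exp_mul_complex_Ioi ha, ofReal_zero, mul_zero, Complex.exp_zero]
  have h_kernel : 2 * Real.pi * I * (u + ((σ : ℤ) : ℂ) * δ * I) = ((σ : ℤ) : ℂ) * a := by
    simp only [a]
    linear_combination 2 * Real.pi * ((σ : ℤ) : ℂ) * δ * I_sq - 2 * Real.pi * I * u * h_sq
  have h_σ : ((σ : ℤ) : ℂ) ≠ 0 := left_ne_zero_of_mul_eq_one h_sq
  rw [h_kernel]
  field_simp
  linear_combination -h_sq

theorem fourierInv_translate_modulate (v : ℝ → ℂ) (c x y : ℝ) :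
    𝓕⁻ (fun t : ℝ => v (t - c) * exp ((-(2 * Real.pi * x * (t - c)) : ℝ) * I)) y =
      exp (2 * Real.pi * I * c * y) * 𝓕⁻ v (y - x) := by
  rw [Real.fourierInv_eq', Real.fourierInv_eq', ← integral_add_right_eq_self _ c,
    ← integral_const_mul]
  refine integral_congr_ae (.of_forall fun t => ?_)
  simp only [add_sub_cancel_right, smul_eq_mul, RCLike.inner_apply, conj_trivial]
  rw [mul_left_comm, ← mul_assoc (exp (2 * Real.pi * I * c * y)), ← Complex.exp_add,
    ← Complex.exp_add, mul_comm (v t)]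
  congr 2
  push_cast
  ring

/-- The Plancherel transform of `y ↦ conj (e^{-iky} / (2πi (y - z)))`, the conjugate of the Cauchy
kernel, for `z = x ± iδ` (see `conj_fourierInv_cauchyKernelFourier`). -/
def cauchyKernelFourier (k : ℝ) (σ : ℤˣ) (δ x t : ℝ) : ℂ :=
  cauchyMultiplier σ δ (t - k / (2 * Real.pi)) *
    exp ((-(2 * Real.pi * x * (t - k / (2 * Real.pi))) : ℝ) * I)

theorem norm_cauchyKernelFourier (k : ℝ) (σ : ℤˣ) (δ x t : ℝ) :
    ‖cauchyKernelFourier k σ δ x t‖ = ‖cauchyMultiplier σ δ (t - k / (2 * Real.pi))‖ := by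
  rw [cauchyKernelFourier, norm_mul, norm_real, norm_exp_ofReal_mul_I, mul_one]

theorem integrable_cauchyKernelFourier (k : ℝ) (σ : ℤˣ) (hδ : 0 < δ) (x : ℝ) :
    Integrable (cauchyKernelFourier k σ δ x) := by
  have h_shift := (integrable_cauchyMultiplier σ hδ).comp_sub_right (k / (2 * Real.pi))
  exact h_shift.norm.mono'
    ((continuous_ofReal.comp_aestronglyMeasurable h_shift.1).mul (by fun_prop))
    (.of_forall fun t => (norm_cauchyKernelFourier k σ δ x t).le)

theorem memLp_cauchyKernelFourier (k : ℝ) (σ : ℤˣ) (hδ : 0 < δ) (x : ℝ) :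
    MemLp (cauchyKernelFourier k σ δ x) 2 :=
  memLp_two_of_integrable_of_bound (integrable_cauchyKernelFourier k σ hδ x)
    (.of_forall fun t => (norm_cauchyKernelFourier k σ δ x t).trans_le
      (norm_cauchyMultiplier_le_one hδ.le _))

theorem conj_fourierInv_cauchyKernelFourier (k : ℝ) (σ : ℤˣ) (hδ : 0 < δ) (x y : ℝ) :
    (starRingEnd ℂ) (𝓕⁻ (cauchyKernelFourier k σ δ x) y) =
      1 / (2 * Real.pi * I) * (exp (-(I * k * y)) / (y - (x + ((σ : ℤ) : ℂ) * δ * I))) := by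
  have h_trans : 𝓕⁻ (cauchyKernelFourier k σ δ x) y = exp (I * k * y) *
      -(1 / (2 * Real.pi * I * (y - x + ((σ : ℤ) : ℂ) * δ * I))) := by
    refine (fourierInv_translate_modulate (fun t => (cauchyMultiplier σ δ t : ℂ)) _ x y).trans ?_
    rw [fourierInv_cauchyMultiplier σ hδ]
    push_cast
    field_simp [Real.pi_ne_zero]
  rw [h_trans]
  simp only [map_mul, map_neg, map_div₀, map_add, map_sub, map_one, map_ofNat, ← Complex.exp_conj,
    conj_I, conj_ofReal, map_intCast]
  rw [show (y : ℂ) - x + ((σ : ℤ) : ℂ) * δ * -I = y - (x + ((σ : ℤ) : ℂ) * δ * I) by ring,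
    show -I * k * y = -(I * k * y) by ring]
  field_simp

theorem exists_eq_add_mul_I {z : ℂ} (hz : z.im ≠ 0) :
    ∃ (σ : ℤˣ) (δ : ℝ), 0 < δ ∧ z = z.re + ((σ : ℤ) : ℂ) * δ * I := by
  rcases lt_or_gt_of_ne hz with h_neg | h_pos
  · exact ⟨-1, -z.im, neg_pos.mpr h_neg, Complex.ext (by simp) (by simp)⟩
  · exact ⟨1, z.im, h_pos, Complex.ext (by simp) (by simp)⟩

variable {h v : ℝ → ℂ}

theorem integrable_cauchyIntegrand (hh : MemLp h 2) (k : ℝ) {z : ℂ} (hz : z.im ≠ 0) :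
    Integrable (cauchyIntegrand k h z) := by
  obtain ⟨σ, δ, hδ, hzδ⟩ := exists_eq_add_mul_I hz
  have h_kernel := memLp_fourierInv (integrable_cauchyKernelFourier k σ hδ z.re)
    (memLp_cauchyKernelFourier k σ hδ z.re)
  refine ((h_kernel.star.integrable_mul hh).const_mul (2 * Real.pi * I)).congr
    (.of_forall fun y => ?_)
  change 2 * Real.pi * I * ((starRingEnd ℂ) (𝓕⁻ (cauchyKernelFourier k σ δ z.re) y) * h y) = _
  rw [conj_fourierInv_cauchyKernelFourier k σ hδ, ← hzδ, cauchyIntegrand]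
  field_simp [Real.pi_ne_zero]

/-- The function whose inverse Fourier transform is the Cauchy integral of `e^{-ikx} h(x)` on the
line `ℝ ± iδ` when `v` is the Plancherel transform of `h`. -/
def cauchyDensity (k : ℝ) (σ : ℤˣ) (δ : ℝ) (v : ℝ → ℂ) (t : ℝ) : ℂ :=
  cauchyMultiplier σ δ t * v (t + k / (2 * Real.pi))

theorem norm_cauchyDensity_le (hδ : 0 ≤ δ) (t : ℝ) :
    ‖cauchyDensity k σ δ v t‖ ≤ ‖v (t + k / (2 * Real.pi))‖ := by
  rw [cauchyDensity, norm_mul, norm_real]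
  exact mul_le_of_le_one_left (norm_nonneg _) (norm_cauchyMultiplier_le_one hδ t)

theorem aestronglyMeasurable_cauchyDensity (hv : AEStronglyMeasurable v) (k : ℝ) (σ : ℤˣ) (δ : ℝ) :
    AEStronglyMeasurable (cauchyDensity k σ δ v) :=
  (measurable_cauchyMultiplier σ δ).complex_ofReal.aestronglyMeasurable.mul
    (hv.comp_measurePreserving (measurePreserving_add_right volume _))

theorem integrable_cauchyDensity (hv : Integrable v) (k : ℝ) (σ : ℤˣ) (hδ : 0 ≤ δ) :
    Integrable (cauchyDensity k σ δ v) :=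
  (hv.comp_add_right _).norm.mono' (aestronglyMeasurable_cauchyDensity hv.1 k σ δ)
    (.of_forall fun t => norm_cauchyDensity_le hδ t)

theorem oscCauchy_eq_fourierInv (hh : MemLp h 2) (k : ℝ) (σ : ℤˣ) (hδ : 0 < δ) (x : ℝ) :
    oscCauchy k h (x + ((σ : ℤ) : ℂ) * δ * I) = 𝓕⁻ (cauchyDensity k σ δ (fourierL2 hh)) x := by
  calc oscCauchy k h (x + ((σ : ℤ) : ℂ) * δ * I)
    _ = ∫ y, ⟪𝓕⁻ (cauchyKernelFourier k σ δ x) y, h y⟫_ℂ := by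
      rw [oscCauchy, ← integral_const_mul]
      refine integral_congr_ae (.of_forall fun y => ?_)
      simp only [RCLike.inner_apply, conj_fourierInv_cauchyKernelFourier k σ hδ, cauchyIntegrand]
      ring
    _ = ∫ t, ⟪cauchyKernelFourier k σ δ x t, fourierL2 hh t⟫_ℂ :=
      integral_inner_fourierInv (integrable_cauchyKernelFourier k σ hδ x)
        (memLp_cauchyKernelFourier k σ hδ x) hh
    _ = 𝓕⁻ (cauchyDensity k σ δ (fourierL2 hh)) x := by
      rw [Real.fourierInv_eq', ← integral_add_right_eq_self _ (k / (2 * Real.pi))]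
      refine integral_congr_ae (.of_forall fun t => ?_)
      simp only [cauchyKernelFourier, cauchyDensity, add_sub_cancel_right, smul_eq_mul,
        RCLike.inner_apply, map_mul, conj_ofReal, ← Complex.exp_conj, conj_I,
        conj_trivial]
      push_cast
      ring_nf

theorem tendsto_fourierInv_cauchyDensity (hv : Integrable v) (k : ℝ) (σ : ℤˣ) (x : ℝ) :
    Tendsto (fun η => 𝓕⁻ (cauchyDensity k σ η v) x) (𝓝[>] 0)
      (𝓝 (𝓕⁻ (cauchyDensity k σ 0 v) x)) := by
  have h_nonneg : ∀ᶠ η : ℝ in 𝓝[>] 0, 0 ≤ η := by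
    filter_upwards [self_mem_nhdsWithin] with η hη using le_of_lt hη
  simp only [Real.fourierInv_eq]
  refine tendsto_integral_filter_of_dominated_convergence
    (fun t => ‖v (t + k / (2 * Real.pi))‖) ?_ ?_ (hv.comp_add_right _).norm ?_
  · filter_upwards [h_nonneg] with η hη
    exact (Real.continuous_fourierChar.comp (by fun_prop)).aestronglyMeasurable.smul
      (integrable_cauchyDensity hv k σ hη).1
  · filter_upwards [h_nonneg] with η hη
    refine .of_forall fun t => ?_
    rw [Circle.norm_smul]
    exact norm_cauchyDensity_le hη t
  · refine .of_forall fun t => (Tendsto.mul_const _ ?_).const_smul _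
    have h_cont := continuous_ofReal.comp (continuous_cauchyMultiplier_left σ t)
    exact (h_cont.tendsto 0).mono_left nhdsWithin_le_nhds

theorem tendsto_oscCauchy (hh : MemSobolevLine 1 h) (k : ℝ) (σ : ℤˣ) (x : ℝ) :
    Tendsto (fun η : ℝ => oscCauchy k h (x + ((σ : ℤ) : ℂ) * η * I)) (𝓝[>] 0)
      (𝓝 (boundaryValue σ (oscCauchy k h) x)) := by
  refine tendsto_nhds_limUnder ⟨_,
    (tendsto_fourierInv_cauchyDensity hh.integrable_fourierL2 k σ x).congr' ?_⟩
  filter_upwards [self_mem_nhdsWithin] with η hη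
  exact (oscCauchy_eq_fourierInv hh.1 k σ hη x).symm

theorem boundaryValue_oscCauchy (hh : MemSobolevLine 1 h) (k : ℝ) (σ : ℤˣ) (x : ℝ) :
    boundaryValue σ (oscCauchy k h) x = 𝓕⁻ (cauchyDensity k σ 0 (fourierL2 hh.1)) x := by
  refine tendsto_nhds_unique ((tendsto_oscCauchy hh k σ x).congr' ?_)
    (tendsto_fourierInv_cauchyDensity hh.integrable_fourierL2 k σ x)
  filter_upwards [self_mem_nhdsWithin] with η hη
  exact oscCauchy_eq_fourierInv hh.1 k σ hη x

theorem lineTrace_oscCauchy (hh : MemSobolevLine 1 h) (k : ℝ) (σ : ℤˣ) (hδ : 0 ≤ δ) :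
    lineTrace σ δ (oscCauchy k h) = 𝓕⁻ (cauchyDensity k σ δ (fourierL2 hh.1)) := by
  ext x
  rcases hδ.eq_or_lt with rfl | hδ
  · rw [lineTrace, if_pos rfl, boundaryValue_oscCauchy hh]
  · rw [lineTrace, if_neg hδ.ne', oscCauchy_eq_fourierInv hh.1 k σ hδ]

end CauchyMultiplier

section LineBounds

variable {k s δ : ℝ} {σ : ℤˣ} {g h v : ℝ → ℂ}

theorem eLpNorm_cauchyDensity_le (hv : AEStronglyMeasurable v) (hδ : 0 ≤ δ) {p : ℝ≥0∞} :
    eLpNorm (cauchyDensity k σ δ v) p ≤ eLpNorm v p := by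
  rw [← eLpNorm_comp_measurePreserving hv
    (measurePreserving_add_right volume (k / (2 * Real.pi)))]
  exact eLpNorm_mono fun t => norm_cauchyDensity_le hδ t

theorem one_add_abs_rpow_le_mul (hs : 0 ≤ s) (ξ k : ℝ) :
    (1 + |ξ|) ^ s ≤ (1 + |k|) ^ s * (1 + |ξ + k|) ^ s := by
  rw [← Real.mul_rpow (by positivity) (by positivity)]
  refine Real.rpow_le_rpow (by positivity) ?_ hs
  have h_tri : |ξ| ≤ |ξ + k| + |k| := by simpa using abs_sub (ξ + k) k
  nlinarith [abs_nonneg k, abs_nonneg (ξ + k)]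

theorem eLpNorm_sobolevWeight_cauchyDensity_le (hv : AEStronglyMeasurable v) (hs : 0 ≤ s)
    (hδ : 0 ≤ δ) : eLpNorm (sobolevWeight s (cauchyDensity k σ δ v)) 2 ≤
      ENNReal.ofReal ((1 + |k|) ^ s) * eLpNorm (sobolevWeight s v) 2 := by
  rw [← eLpNorm_comp_measurePreserving (aestronglyMeasurable_sobolevWeight hv)
    (measurePreserving_add_right volume k)]
  refine eLpNorm_le_mul_eLpNorm_of_ae_le_mul (.of_forall fun ξ => ?_) 2
  have h_density := norm_cauchyDensity_le (k := k) (σ := σ) (v := v) hδ (ξ / (2 * Real.pi))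
  rw [← add_div] at h_density
  simp only [sobolevWeight, Function.comp_apply, norm_mul, norm_real, ← mul_assoc]
  rw [Real.norm_of_nonneg (by positivity), Real.norm_of_nonneg (by positivity)]
  exact mul_le_mul (one_add_abs_rpow_le_mul hs ξ k) h_density (norm_nonneg _) (by positivity)

theorem memLp_cauchyDensity (hv : MemLp v 2) (hδ : 0 ≤ δ) : MemLp (cauchyDensity k σ δ v) 2 :=
  ⟨aestronglyMeasurable_cauchyDensity hv.1 k σ δ, (eLpNorm_cauchyDensity_le hv.1 hδ).trans_lt hv.2⟩

theorem eLpNorm_lineTrace_oscCauchy_le (hh : MemSobolevLine 1 h) (hδ : 0 ≤ δ) :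
    eLpNorm (lineTrace σ δ (oscCauchy k h)) 2 ≤ eLpNorm h 2 := by
  rw [lineTrace_oscCauchy hh k σ hδ, eLpNorm_fourierInv
    (integrable_cauchyDensity hh.integrable_fourierL2 k σ hδ)
    (memLp_cauchyDensity (memLp_fourierL2 hh.1) hδ), ← eLpNorm_fourierL2 hh.1]
  exact eLpNorm_cauchyDensity_le (memLp_fourierL2 hh.1).1 hδ

theorem sobolevNorm_lineTrace_oscCauchy (hh : MemSobolevLine 1 h) (hδ : 0 ≤ δ) :
    sobolevNorm s (lineTrace σ δ (oscCauchy k h)) =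
      eLpNorm (sobolevWeight s (cauchyDensity k σ δ (fourierL2 hh.1))) 2 := by
  have h_int := integrable_cauchyDensity hh.integrable_fourierL2 k σ hδ
  have h_mem := memLp_cauchyDensity (k := k) (σ := σ) (memLp_fourierL2 hh.1) hδ
  rw [lineTrace_oscCauchy hh k σ hδ, sobolevNorm_eq s (memLp_fourierInv h_int h_mem)]
  exact eLpNorm_congr_ae (sobolevWeight_congr (fourierL2_fourierInv h_int h_mem))

theorem sobolevNorm_lineTrace_oscCauchy_le (hh : MemSobolevLine 1 h) (hs : 0 ≤ s) (hδ : 0 ≤ δ) :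
    sobolevNorm s (lineTrace σ δ (oscCauchy k h)) ≤
      ENNReal.ofReal ((1 + |k|) ^ s) * sobolevNorm s h := by
  rw [sobolevNorm_lineTrace_oscCauchy hh hδ, sobolevNorm_eq s hh.1]
  exact eLpNorm_sobolevWeight_cauchyDensity_le (memLp_fourierL2 hh.1).1 hs hδ

theorem enorm_lineTrace_oscCauchy_le (hh : MemSobolevLine 1 h) (hδ : 0 ≤ δ) (x : ℝ) :
    ‖lineTrace σ δ (oscCauchy k h) x‖ₑ ≤ sobolevNorm 1 (lineTrace σ 0 (oscCauchy k h)) := by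
  have h_meas := (integrable_cauchyDensity hh.integrable_fourierL2 k σ (le_refl 0)).1
  rw [lineTrace_oscCauchy hh k σ hδ, sobolevNorm_lineTrace_oscCauchy hh le_rfl, Real.fourierInv_eq]
  refine (enorm_integral_le_lintegral_enorm _).trans
    (le_trans ?_ (eLpNorm_one_le_sobolevWeight h_meas))
  rw [eLpNorm_one_eq_lintegral_enorm]
  refine lintegral_mono fun t => ?_
  rw [enorm_le_iff_norm_le, Circle.norm_smul, cauchyDensity, cauchyDensity, norm_mul, norm_mul,
    norm_real, norm_real]
  gcongr
  exact norm_cauchyMultiplier_antitone σ t hδ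

theorem oscCauchy_sub (hg : MemLp g 2) (hh : MemLp h 2) {z : ℂ} (hz : z.im ≠ 0) :
    oscCauchy k (g - h) z = oscCauchy k g z - oscCauchy k h z := by
  rw [oscCauchy, oscCauchy, oscCauchy, ← mul_sub, ← integral_sub
    (integrable_cauchyIntegrand hg k hz) (integrable_cauchyIntegrand hh k hz)]
  simp only [cauchyIntegrand, Pi.sub_apply, mul_sub, sub_div]

theorem lineTrace_oscCauchy_sub (hg : MemSobolevLine 1 g) (hh : MemSobolevLine 1 h)
    (hδ : 0 ≤ δ) : lineTrace σ δ (oscCauchy k (g - h)) =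
      lineTrace σ δ (oscCauchy k g) - lineTrace σ δ (oscCauchy k h) := by
  have h_line : ∀ η x : ℝ, 0 < η → oscCauchy k (g - h) (x + ((σ : ℤ) : ℂ) * η * I) =
      oscCauchy k g (x + ((σ : ℤ) : ℂ) * η * I) - oscCauchy k h (x + ((σ : ℤ) : ℂ) * η * I) :=
    fun η x hη => oscCauchy_sub hg.1 hh.1 (by simp [hη.ne'])
  ext x
  simp only [lineTrace, Pi.sub_apply]
  split_ifs with h_zero
  · refine tendsto_nhds_unique (tendsto_oscCauchy (hg.sub hh) k σ x)
      (((tendsto_oscCauchy hg k σ x).sub (tendsto_oscCauchy hh k σ x)).congr' ?_)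
    filter_upwards [self_mem_nhdsWithin] with η hη using (h_line η x hη).symm
  · exact h_line δ x (hδ.lt_of_ne' h_zero)

theorem MemSobolevLine.tendsto_cocompact (hh : MemSobolevLine 1 h) (hc : Continuous h) :
    Tendsto h (cocompact ℝ) (𝓝 0) := by
  have h_reflect : h = 𝓕 (fourierL2 hh.1) ∘ fun x => -x := by
    ext x
    rw [Function.comp_apply, ← Real.fourierInv_eq_fourier_neg,
      fourierInv_fourierL2_eq hc hh.1 hh.integrable_fourierL2]
  rw [h_reflect]
  exact (Real.zero_at_infty_fourier _).comp
    (Homeomorph.neg ℝ).isClosedEmbedding.tendsto_cocompact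

end LineBounds

section UniformConvergence

variable {ι : Type*} {l : Filter ι} {B : ι → ℝ≥0∞}

theorem tendstoUniformlyOn_of_enorm_sub_le {α E : Type*} [SeminormedAddCommGroup E]
    {F : ι → α → E} {g : α → E} {S : Set α} (hB : Tendsto B l (𝓝 0))
    (hF : ∀ᶠ i in l, ∀ x ∈ S, ‖g x - F i x‖ₑ ≤ B i) : TendstoUniformlyOn F g l S := by
  rw [EMetric.tendstoUniformlyOn_iff]
  intro r hr
  filter_upwards [hF, hB.eventually_lt_const hr] with i hFi hBi x hx
  rw [edist_eq_enorm_sub]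
  exact (hFi x hx).trans_lt hBi

variable {Φ : ι → ℂ → ℂ} {Ψ : ℂ → ℂ}

theorem tendstoUniformlyOn_of_lineTrace (hB : Tendsto B l (𝓝 0))
    (hΦ : ∀ᶠ i in l, ∀ (σ : ℤˣ) (δ : ℝ), 0 ≤ δ →
      ⨆ x, ‖lineTrace σ δ Ψ x - lineTrace σ δ (Φ i) x‖ₑ ≤ B i) :
    TendstoUniformlyOn Φ Ψ l {z | z.im ≠ 0} := by
  refine tendstoUniformlyOn_of_enorm_sub_le hB (hΦ.mono fun i hi z hz => ?_)
  obtain ⟨σ, δ, hδ, hzδ⟩ := exists_eq_add_mul_I hz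
  have h_trace : ∀ Θ : ℂ → ℂ, lineTrace σ δ Θ z.re = Θ z := fun Θ => by
    rw [lineTrace, if_neg hδ.ne', ← hzδ]
  rw [← h_trace Ψ, ← h_trace (Φ i)]
  exact iSup_le_iff.mp (hi σ δ hδ.le) z.re

theorem tendstoUniformly_boundaryValue_of_lineTrace {σ : ℤˣ} (hB : Tendsto B l (𝓝 0))
    (hΦ : ∀ᶠ i in l, ⨆ x, ‖lineTrace σ 0 Ψ x - lineTrace σ 0 (Φ i) x‖ₑ ≤ B i) :
    TendstoUniformly (fun i => boundaryValue σ (Φ i)) (boundaryValue σ Ψ) l := by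
  rw [← tendstoUniformlyOn_univ]
  refine tendstoUniformlyOn_of_enorm_sub_le hB (hΦ.mono fun i hi x _ => ?_)
  simpa only [lineTrace, if_true] using iSup_le_iff.mp hi x

end UniformConvergence

section MoebiusPowers

theorem norm_zpow_sub_one_le {K : Type*} [NormedDivisionRing K] {z : K} (hz : ‖z‖ = 1) (j : ℤ) :
    ‖z ^ j - 1‖ ≤ |(j : ℝ)| * ‖z - 1‖ := by
  have h_nat : ∀ m : ℕ, ‖z ^ m - 1‖ ≤ m * ‖z - 1‖ := fun m => by
    rw [← geom_sum_mul z m, norm_mul]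
    gcongr
    simpa [hz] using norm_sum_le (Finset.range m) fun i => z ^ i
  obtain ⟨m, rfl | rfl⟩ := j.eq_nat_or_neg
  · simpa using h_nat m
  · have h_inv : z ^ (-(m : ℤ)) - 1 = -(z ^ (-(m : ℤ)) * (z ^ m - 1)) := by
      have hz0 : z ≠ 0 := norm_ne_zero_iff.mp (hz.trans_ne one_ne_zero)
      rw [mul_sub, zpow_neg, zpow_natCast, inv_mul_cancel₀ (pow_ne_zero _ hz0), mul_one, neg_sub]
    rw [h_inv, norm_neg, norm_mul, norm_zpow, hz, one_zpow, one_mul]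
    simpa using h_nat m

theorem norm_zpow_sub_zpow_le {K : Type*} [NormedDivisionRing K] {z : K} (hz : ‖z‖ = 1)
    (a b : ℤ) : ‖z ^ a - z ^ b‖ ≤ |((a - b : ℤ) : ℝ)| * ‖z - 1‖ := by
  have hz0 : z ≠ 0 := norm_ne_zero_iff.mp (hz.trans_ne one_ne_zero)
  have h_factor : z ^ a - z ^ b = z ^ b * (z ^ (a - b) - 1) := by
    rw [mul_sub, ← zpow_add₀ hz0, add_sub_cancel, mul_one]
  rw [h_factor, norm_mul, norm_zpow, hz, one_zpow, one_mul]
  exact norm_zpow_sub_one_le hz (a - b)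

/-- The density `2β / (x² + β²)` of the angle `arg M_β(x)`: the substitution `θ = arg M_β(x)` turns
`∫ g(M_β(x)) 2β / (x² + β²) dx` over the line into `∫ g(e^{iθ}) dθ` over a period. -/
def moebiusDensity (β x : ℝ) : ℝ :=
  2 * β / (x ^ 2 + β ^ 2)

section NeZero

variable {β : ℝ} (hβ : β ≠ 0)
include hβ

theorem ofReal_add_I_mul_ne_zero (x : ℝ) : (x : ℂ) + I * β ≠ 0 := fun h =>
  hβ (by simpa using congrArg Complex.im h)

theorem ofReal_sub_I_mul_ne_zero (x : ℝ) : (x : ℂ) - I * β ≠ 0 := fun h =>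
  hβ (by simpa using congrArg Complex.im h)

theorem moebius_ne_zero (x : ℝ) : moebius β x ≠ 0 :=
  div_ne_zero (ofReal_sub_I_mul_ne_zero hβ x) (ofReal_add_I_mul_ne_zero hβ x)

theorem norm_moebius (x : ℝ) : ‖moebius β x‖ = 1 := by
  have h_conj : (x : ℂ) - I * β = (starRingEnd ℂ) (x + I * β) := by simp [sub_eq_add_neg]
  rw [moebius, norm_div, h_conj, RCLike.norm_conj,
    div_self (norm_ne_zero_iff.mpr (ofReal_add_I_mul_ne_zero hβ x))]

theorem norm_moebius_zpow (x : ℝ) (j : ℤ) : ‖moebius β x ^ j‖ = 1 := by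
  rw [norm_zpow, norm_moebius hβ, one_zpow]

theorem moebius_sub_one (x : ℝ) : moebius β x - 1 = -(2 * I * β) / (x + I * β) := by
  have h_den := ofReal_add_I_mul_ne_zero hβ x
  rw [moebius]
  field_simp
  ring

theorem moebius_ne_one (x : ℝ) : moebius β x ≠ 1 := by
  rw [← sub_ne_zero, moebius_sub_one hβ]
  exact div_ne_zero (by simpa using hβ) (ofReal_add_I_mul_ne_zero hβ x)

omit hβ in
theorem ofReal_moebiusDensity (x : ℝ) :
    (moebiusDensity β x : ℂ) = 2 * β / ((x + I * β) * (x - I * β)) := by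
  have h_den : ((x : ℂ) + I * β) * (x - I * β) = x ^ 2 + β ^ 2 := by
    linear_combination -(β : ℂ) ^ 2 * I_sq
  rw [h_den, moebiusDensity]
  push_cast
  rfl

theorem hasDerivAt_moebius_zpow (j : ℤ) (x : ℝ) :
    HasDerivAt (fun x : ℝ => moebius β x ^ j)
      (I * j * (moebiusDensity β x * moebius β x ^ j)) x := by
  have h_add := ofReal_add_I_mul_ne_zero hβ x
  have h_sub := ofReal_sub_I_mul_ne_zero hβ x
  have h_moebius : HasDerivAt (fun x : ℝ => moebius β x)
      ((1 * (x + I * β) - (x - I * β) * 1) / (x + I * β) ^ 2) x :=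
    ((Complex.ofRealCLM.hasDerivAt).sub_const _).div
      ((Complex.ofRealCLM.hasDerivAt).add_const _) h_add
  refine ((hasDerivAt_zpow j (moebius β x) (.inl (moebius_ne_zero hβ x))).comp x
    h_moebius).congr_deriv ?_
  rw [zpow_sub_one₀ (moebius_ne_zero hβ x), ofReal_moebiusDensity]
  generalize moebius β x ^ j = w
  rw [moebius]
  field_simp
  ring

theorem continuous_moebius_zpow (j : ℤ) : Continuous fun x : ℝ => moebius β x ^ j :=
  continuous_iff_continuousAt.mpr fun x => (hasDerivAt_moebius_zpow hβ j x).continuousAt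

theorem continuous_moebiusDensity : Continuous (moebiusDensity β) :=
  continuous_const.div (by fun_prop) fun x => by positivity

theorem moebiusDensity_eq (x : ℝ) : moebiusDensity β x = 2 / β * (1 + (x / β) ^ 2)⁻¹ := by
  rw [moebiusDensity]
  field_simp
  rw [add_comm]

theorem integrable_moebiusDensity : Integrable (moebiusDensity β) := by
  simp only [funext (moebiusDensity_eq hβ)]
  exact (integrable_inv_one_add_sq.comp_div hβ).const_mul _

theorem norm_moebius_sub_one_mul_abs_le (x : ℝ) : ‖moebius β x - 1‖ * |x| ≤ 2 * |β| := by
  have h_abs : |x| ≤ ‖(x : ℂ) + I * β‖ := by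
    simpa using Complex.abs_re_le_norm ((x : ℂ) + I * β)
  rw [moebius_sub_one hβ, norm_div, div_mul_eq_mul_div,
    div_le_iff₀ (norm_pos_iff.mpr (ofReal_add_I_mul_ne_zero hβ x))]
  gcongr
  simp

theorem tendsto_moebius_cocompact : Tendsto (fun x : ℝ => moebius β x) (cocompact ℝ) (𝓝 1) := by
  rw [tendsto_iff_norm_sub_tendsto_zero]
  have h_abs : Tendsto (fun x : ℝ => |x|) (cocompact ℝ) atTop := tendsto_norm_cocompact_atTop
  refine squeeze_zero' (.of_forall fun x => norm_nonneg _) ?_ (h_abs.const_div_atTop (2 * |β|))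
  filter_upwards [h_abs.eventually_gt_atTop 0] with x hx
  exact (le_div_iff₀ hx).mpr (norm_moebius_sub_one_mul_abs_le hβ x)

theorem integrable_moebiusDensity_mul_zpow (j : ℤ) :
    Integrable fun x : ℝ => (moebiusDensity β x : ℂ) * moebius β x ^ j := by
  refine (integrable_moebiusDensity hβ).norm.mono' ?_ (.of_forall fun x => ?_)
  · exact ((continuous_ofReal.comp (continuous_moebiusDensity hβ)).mul
      (continuous_moebius_zpow hβ j)).aestronglyMeasurable
  · rw [norm_mul, norm_moebius_zpow hβ, mul_one, norm_real]

theorem integral_moebiusDensity_mul_zpow_of_ne_zero {j : ℤ} (hj : j ≠ 0) :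
    ∫ x : ℝ, (moebiusDensity β x : ℂ) * moebius β x ^ j = 0 := by
  have hj' : (I * j : ℂ) ≠ 0 := mul_ne_zero I_ne_zero (by exact_mod_cast hj)
  have h_deriv : ∀ x : ℝ, HasDerivAt (fun x : ℝ => (I * j : ℂ)⁻¹ * moebius β x ^ j)
      (moebiusDensity β x * moebius β x ^ j) x := fun x =>
    ((hasDerivAt_moebius_zpow hβ j x).const_mul _).congr_deriv (inv_mul_cancel_left₀ hj' _)
  have h_lim := ((tendsto_moebius_cocompact hβ).zpow₀ j (.inl one_ne_zero)).const_mul (I * j : ℂ)⁻¹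
  rw [integral_of_hasDerivAt_of_tendsto h_deriv (integrable_moebiusDensity_mul_zpow hβ j)
    (h_lim.mono_left atBot_le_cocompact) (h_lim.mono_left atTop_le_cocompact), sub_self]

theorem moebiusDensity_mul_norm_sum_sq (S : Finset ℤ) (c : ℤ → ℂ) (x : ℝ) :
    ((moebiusDensity β x * ‖∑ i ∈ S, c i * moebius β x ^ i‖ ^ 2 : ℝ) : ℂ) =
      ∑ i ∈ S, ∑ j ∈ S, c i * (starRingEnd ℂ) (c j) *
        (moebiusDensity β x * moebius β x ^ (i - j)) := by
  have h_conj : (starRingEnd ℂ) (moebius β x) = (moebius β x)⁻¹ :=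
    (Complex.inv_eq_conj (norm_moebius hβ x)).symm
  push_cast
  rw [← Complex.mul_conj', map_sum, Finset.sum_mul_sum, Finset.mul_sum]
  refine Finset.sum_congr rfl fun i _ => ?_
  rw [Finset.mul_sum]
  refine Finset.sum_congr rfl fun j _ => ?_
  rw [map_mul, map_zpow₀, h_conj, inv_zpow', sub_eq_add_neg, zpow_add₀ (moebius_ne_zero hβ x)]
  ring

theorem integrable_moebiusDensity_mul_norm_sq (S : Finset ℤ) (c : ℤ → ℂ) :
    Integrable fun x : ℝ => moebiusDensity β x * ‖∑ i ∈ S, c i * moebius β x ^ i‖ ^ 2 := by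
  have h_complex : Integrable fun x : ℝ =>
      ((moebiusDensity β x * ‖∑ i ∈ S, c i * moebius β x ^ i‖ ^ 2 : ℝ) : ℂ) := by
    simp only [moebiusDensity_mul_norm_sum_sq hβ]
    exact integrable_finsetSum _ fun i _ => integrable_finsetSum _ fun j _ =>
      (integrable_moebiusDensity_mul_zpow hβ (i - j)).const_mul _
  simpa only [RCLike.re_to_complex, ofReal_re] using h_complex.re

end NeZero

section Positive

variable {β : ℝ} (hβ : 0 < β)
include hβ

theorem moebiusDensity_pos (x : ℝ) : 0 < moebiusDensity β x := by
  rw [moebiusDensity]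
  positivity

theorem moebiusDensity_le (x : ℝ) : moebiusDensity β x ≤ 2 / β := by
  rw [moebiusDensity, div_le_div_iff₀ (by positivity) hβ]
  nlinarith [sq_nonneg x]

theorem integral_moebiusDensity : ∫ x, moebiusDensity β x = 2 * Real.pi := by
  simp only [moebiusDensity_eq hβ.ne']
  rw [integral_const_mul, Measure.integral_comp_div (fun x => (1 + x ^ 2)⁻¹) β,
    integral_univ_inv_one_add_sq, abs_of_pos hβ, smul_eq_mul]
  field_simp

theorem integral_moebiusDensity_mul_zpow (j : ℤ) :
    ∫ x : ℝ, (moebiusDensity β x : ℂ) * moebius β x ^ j =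
      if j = 0 then (2 * Real.pi : ℂ) else 0 := by
  split_ifs with hj
  · simp only [hj, zpow_zero, mul_one]
    rw [integral_complex_ofReal, integral_moebiusDensity hβ, ofReal_mul, ofReal_ofNat]
  · exact integral_moebiusDensity_mul_zpow_of_ne_zero hβ.ne' hj

theorem integral_moebiusDensity_mul_norm_sq (S : Finset ℤ) (c : ℤ → ℂ) :
    ∫ x : ℝ, moebiusDensity β x * ‖∑ i ∈ S, c i * moebius β x ^ i‖ ^ 2 =
      2 * Real.pi * ∑ i ∈ S, ‖c i‖ ^ 2 := by
  have h_term : ∀ i j : ℤ, Integrable fun x : ℝ => c i * (starRingEnd ℂ) (c j) *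
      ((moebiusDensity β x : ℂ) * moebius β x ^ (i - j)) := fun i j =>
    (integrable_moebiusDensity_mul_zpow hβ.ne' (i - j)).const_mul _
  rw [← Complex.ofReal_inj, ← integral_complex_ofReal]
  simp only [moebiusDensity_mul_norm_sum_sq hβ.ne']
  rw [integral_finsetSum _ fun i _ => integrable_finsetSum _ fun j _ => h_term i j,
    Finset.mul_sum, ofReal_sum]
  refine Finset.sum_congr rfl fun i hi => ?_
  rw [integral_finsetSum _ fun j _ => h_term i j]
  simp only [integral_const_mul, integral_moebiusDensity_mul_zpow hβ, sub_eq_zero, mul_ite,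
    mul_zero, Finset.sum_ite_eq, if_pos hi, Complex.mul_conj']
  push_cast
  ring

theorem eLpNorm_moebiusDensity_mul_sum_le (S : Finset ℤ) (c : ℤ → ℂ) :
    eLpNorm (fun x : ℝ => (moebiusDensity β x : ℂ) * ∑ i ∈ S, c i * moebius β x ^ i) 2 ≤
      ENNReal.ofReal √(4 * Real.pi / β * ∑ i ∈ S, ‖c i‖ ^ 2) := by
  have h_integral : 4 * Real.pi / β * ∑ i ∈ S, ‖c i‖ ^ 2 =
      ∫ x : ℝ, 2 / β * (moebiusDensity β x * ‖∑ i ∈ S, c i * moebius β x ^ i‖ ^ 2) := by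
    rw [integral_const_mul, integral_moebiusDensity_mul_norm_sq hβ]
    ring
  rw [h_integral]
  refine eLpNorm_two_le_of_norm_sq_le
    ((integrable_moebiusDensity_mul_norm_sq hβ.ne' S c).const_mul _) (.of_forall fun x => ?_)
  have h_nonneg := (moebiusDensity_pos hβ x).le
  rw [norm_mul, mul_pow, norm_real, Real.norm_of_nonneg h_nonneg, sq (moebiusDensity β x),
    mul_assoc]
  exact mul_le_mul_of_nonneg_right (moebiusDensity_le hβ x) (by positivity)

theorem norm_moebius_zpow_sub_zpow_sq_le {a b : ℤ} {A : ℝ} (hA : 0 < A)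
    (hab : β * |((a - b : ℤ) : ℝ)| ≤ A) (x : ℝ) :
    ‖moebius β x ^ a - moebius β x ^ b‖ ^ 2 ≤ 4 * A * moebiusDensity A x := by
  have h_two : ‖moebius β x ^ a - moebius β x ^ b‖ ≤ 2 := by
    refine (norm_sub_le _ _).trans_eq ?_
    rw [norm_moebius_zpow hβ.ne', norm_moebius_zpow hβ.ne', one_add_one_eq_two]
  have h_decay : ‖moebius β x ^ a - moebius β x ^ b‖ * |x| ≤ 2 * A := by
    calc ‖moebius β x ^ a - moebius β x ^ b‖ * |x|
      _ ≤ |((a - b : ℤ) : ℝ)| * ‖moebius β x - 1‖ * |x| := by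
        gcongr
        exact norm_zpow_sub_zpow_le (norm_moebius hβ.ne' x) a b
      _ ≤ |((a - b : ℤ) : ℝ)| * (2 * |β|) := by
        rw [mul_assoc]
        exact mul_le_mul_of_nonneg_left (norm_moebius_sub_one_mul_abs_le hβ.ne' x) (abs_nonneg _)
      _ ≤ 2 * A := by
        rw [abs_of_pos hβ]
        linarith
  rw [moebiusDensity, mul_div_assoc', le_div_iff₀ (by positivity)]
  have h_sq_two := pow_le_pow_left₀ (norm_nonneg _) h_two 2
  have h_sq_decay := pow_le_pow_left₀ (by positivity) h_decay 2
  rw [mul_pow, sq_abs] at h_sq_decay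
  nlinarith [mul_le_mul_of_nonneg_right h_sq_two (sq_nonneg A)]

theorem eLpNorm_moebius_zpow_sub_zpow_le (a b : ℤ) :
    eLpNorm (fun x : ℝ => moebius β x ^ a - moebius β x ^ b) 2 ≤
      ENNReal.ofReal √(8 * Real.pi * β * |((a - b : ℤ) : ℝ)|) := by
  rcases eq_or_ne a b with rfl | hab
  · simp
  have : 0 < |((a - b : ℤ) : ℝ)| := abs_pos.mpr (by exact_mod_cast sub_ne_zero.mpr hab)
  have hA : 0 < β * |((a - b : ℤ) : ℝ)| := by positivity
  have h_integral : 8 * Real.pi * β * |((a - b : ℤ) : ℝ)| =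
      ∫ x, 4 * (β * |((a - b : ℤ) : ℝ)|) * moebiusDensity (β * |((a - b : ℤ) : ℝ)|) x := by
    rw [integral_const_mul, integral_moebiusDensity hA]
    ring
  rw [h_integral]
  exact eLpNorm_two_le_of_norm_sq_le ((integrable_moebiusDensity hA.ne').const_mul _)
    (.of_forall fun x => norm_moebius_zpow_sub_zpow_sq_le hβ hA le_rfl x)

end Positive

end MoebiusPowers

section Pullback

theorem hasSum_periodicCoeff_mul_exp {F : ℝ → ℂ} (hF : Continuous F)
    (hper : Function.Periodic F (2 * Real.pi)) (hs : Summable (periodicCoeff F)) (θ : ℝ) :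
    HasSum (fun j : ℤ => periodicCoeff F j * exp (θ * I) ^ j) (F θ) := by
  have : Fact (0 < 2 * Real.pi) := ⟨Real.two_pi_pos⟩
  let G : C(AddCircle (2 * Real.pi), ℂ) := ⟨hper.lift, hF.quotient_lift _⟩
  have h_coe : ∀ x : ℝ, G x = F x := hper.lift_coe
  have h_coeff : fourierCoeff G = periodicCoeff F := by
    ext j
    rw [periodicCoeff, fourierCoeffOn_eq_integral, fourierCoeff_eq_intervalIntegral _ _ 0]
    simp [h_coe]
  have h_sum := has_pointwise_sum_fourier_series_of_summable (f := G) (by rwa [h_coeff]) θ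
  have h_fourier : ∀ j : ℤ, fourier j (θ : AddCircle (2 * Real.pi)) = exp (θ * I) ^ j := fun j => by
    have hpi : (Real.pi : ℂ) ≠ 0 := by exact_mod_cast Real.pi_ne_zero
    rw [fourier_coe_apply, ← Complex.exp_int_mul]
    congr 1
    push_cast
    field_simp
  simpa only [h_coe, h_coeff, h_fourier, smul_eq_mul] using h_sum

theorem pullback_congr_of_exp_eq (β : ℝ) (f : ℝ → ℂ) {θ θ' : ℝ} (h : exp (θ * I) = exp (θ' * I)) :
    pullback β f θ = pullback β f θ' := by
  simp only [pullback, lineParam, h]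

theorem periodic_pullback (β : ℝ) (f : ℝ → ℂ) :
    Function.Periodic (pullback β f) (2 * Real.pi) := fun θ =>
  pullback_congr_of_exp_eq β f <| by
    push_cast
    rw [add_mul, Complex.exp_periodic]

theorem ofReal_lineParam (β θ : ℝ) : (lineParam β θ : ℂ) = moebiusInv β (exp (θ * I)) :=
  Complex.ext (by simp [lineParam]) (by simp [moebiusInv_exp_im])

theorem abs_lineParam (β θ : ℝ) :
    |lineParam β θ| = |β| * (‖exp (θ * I) + 1‖ / ‖exp (θ * I) - 1‖) := by
  rw [← Real.norm_eq_abs, ← Complex.norm_real, ofReal_lineParam, moebiusInv]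
  simp

theorem continuousAt_lineParam (β : ℝ) {θ : ℝ} (hθ : exp (θ * I) ≠ 1) :
    ContinuousAt (lineParam β) θ := by
  have h_ne : exp (θ * I) - 1 ≠ 0 := sub_ne_zero.mpr hθ
  unfold lineParam moebiusInv
  fun_prop (disch := assumption)

variable {β : ℝ} (hβ : β ≠ 0)
include hβ

theorem tendsto_lineParam_cocompact {θ : ℝ} (hθ : exp (θ * I) = 1) :
    Tendsto (lineParam β) (𝓝[{φ | exp (φ * I) ≠ 1}] θ) (cocompact ℝ) := by
  rw [← Metric.cobounded_eq_cocompact, ← comap_norm_atTop, tendsto_comap_iff]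
  simp only [Function.comp_def, Real.norm_eq_abs, abs_lineParam, div_eq_mul_inv]
  have h_num : Tendsto (fun φ : ℝ => ‖exp (φ * I) + 1‖) (𝓝[{φ | exp (φ * I) ≠ 1}] θ) (𝓝 2) :=
    Continuous.tendsto' (by fun_prop) _ _ (by rw [hθ]; norm_num) |>.mono_left nhdsWithin_le_nhds
  have h_den : Tendsto (fun φ : ℝ => ‖exp (φ * I) - 1‖) (𝓝[{φ | exp (φ * I) ≠ 1}] θ) (𝓝[>] 0) := by
    refine tendsto_nhdsWithin_iff.mpr ⟨?_, ?_⟩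
    · exact Continuous.tendsto' (by fun_prop) _ _ (by rw [hθ, sub_self, norm_zero])
        |>.mono_left nhdsWithin_le_nhds
    · filter_upwards [self_mem_nhdsWithin] with φ hφ
      exact norm_pos_iff.mpr (sub_ne_zero.mpr hφ)
  exact (h_num.pos_mul_atTop two_pos h_den.inv_tendsto_nhdsGT_zero).const_mul_atTop
    (abs_pos.mpr hβ)

theorem continuous_pullback {f : ℝ → ℂ} (hc : Continuous f)
    (h0 : Tendsto f (cocompact ℝ) (𝓝 0)) : Continuous (pullback β f) := by
  refine continuous_iff_continuousAt.mpr fun θ => ?_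
  by_cases hθ : exp (θ * I) = 1
  · have h_infty : Tendsto (pullback β f) (𝓝[{φ | exp (φ * I) = 1}] θ) (𝓝 0) :=
      tendsto_const_nhds.congr' (eventually_nhdsWithin_of_forall fun φ hφ => (if_pos hφ).symm)
    have h_line : Tendsto (pullback β f) (𝓝[{φ | exp (φ * I) ≠ 1}] θ) (𝓝 0) :=
      (h0.comp (tendsto_lineParam_cocompact hβ hθ)).congr'
        (eventually_nhdsWithin_of_forall fun φ hφ => (if_neg hφ).symm)
    rw [ContinuousAt, pullback, if_pos hθ]
    simpa only [← nhdsWithin_union, ← Set.compl_ofPred, Set.union_compl_self, nhdsWithin_univ]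
      using h_infty.sup h_line
  · have h_ne : ∀ᶠ φ : ℝ in 𝓝 θ, exp (φ * I) ≠ 1 :=
      ContinuousAt.eventually_ne (g := fun φ : ℝ => exp (φ * I)) (by fun_prop) hθ
    exact (hc.continuousAt.comp (continuousAt_lineParam β hθ)).congr
      (h_ne.mono fun φ hφ => (if_neg hφ).symm)

theorem moebiusInv_moebius (x : ℝ) : moebiusInv β (moebius β x) = x := by
  have h_den := ofReal_add_I_mul_ne_zero hβ x
  have hβ' : (β : ℂ) ≠ 0 := by exact_mod_cast hβ
  have h_add_one : moebius β x + 1 = 2 * x / (x + I * β) := by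
    rw [moebius]
    field_simp
    ring
  rw [moebiusInv, moebius_sub_one hβ, h_add_one, div_div_div_cancel_right₀ h_den]
  field_simp
  rw [I_sq]
  ring

theorem pullback_eq (f : ℝ → ℂ) {x θ : ℝ} (h : exp (θ * I) = moebius β x) :
    pullback β f θ = f x := by
  rw [pullback, if_neg (h ▸ moebius_ne_one hβ x), lineParam, h, moebiusInv_moebius hβ, ofReal_re]

theorem exp_arg_moebius (x : ℝ) : exp (arg (moebius β x) * I) = moebius β x := by
  simpa only [norm_moebius hβ, ofReal_one, one_mul] using norm_mul_exp_arg_mul_I (moebius β x)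

theorem hasSum_periodicCoeff_pullback {f : ℝ → ℂ} (hc : Continuous f)
    (h0 : Tendsto f (cocompact ℝ) (𝓝 0)) (hs : Summable (periodicCoeff (pullback β f))) (θ : ℝ) :
    HasSum (fun j : ℤ => periodicCoeff (pullback β f) j * exp (θ * I) ^ j) (pullback β f θ) :=
  hasSum_periodicCoeff_mul_exp (continuous_pullback hβ hc h0) (periodic_pullback β f) hs θ

theorem hasSum_periodicCoeff_mul_moebius_zpow {f : ℝ → ℂ} (hc : Continuous f)
    (h0 : Tendsto f (cocompact ℝ) (𝓝 0)) (hs : Summable (periodicCoeff (pullback β f))) (x : ℝ) :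
    HasSum (fun j : ℤ => periodicCoeff (pullback β f) j * moebius β x ^ j) (f x) := by
  have h_exp := exp_arg_moebius hβ x
  simpa only [h_exp, pullback_eq hβ f h_exp] using
    hasSum_periodicCoeff_pullback hβ hc h0 hs (arg (moebius β x))

end Pullback

section Aliasing

/-- The frequencies `-⌊(n-1)/2⌋, …, ⌊n/2⌋` of the interpolant `ratInterp β n f`. -/
def aliasWindow (n : ℕ) : Finset ℤ :=
  Finset.Icc (-(((n - 1) / 2 : ℕ) : ℤ)) ((n / 2 : ℕ) : ℤ)

/-- The representative of `j` modulo `n` in `aliasWindow n`: on the interpolation nodes the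
frequencies `j` and `aliasIndex n j` coincide. -/
def aliasIndex (n : ℕ) (j : ℤ) : ℤ :=
  (j + ((n - 1) / 2 : ℕ)) % n - ((n - 1) / 2 : ℕ)

theorem dvd_sub_aliasIndex (n : ℕ) (j : ℤ) : (n : ℤ) ∣ j - aliasIndex n j := by
  rw [aliasIndex, ← sub_add, sub_add_eq_add_sub]
  exact Int.dvd_self_sub_emod

theorem two_mul_abs_le_of_mem_aliasWindow {n : ℕ} {i : ℤ} (hi : i ∈ aliasWindow n) :
    2 * |i| ≤ n := by
  rw [aliasWindow, Finset.mem_Icc] at hi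
  rcases abs_cases i with ⟨h, -⟩ | ⟨h, -⟩ <;> omega

variable {n : ℕ} (hn : n ≠ 0)
include hn

theorem card_aliasWindow : (aliasWindow n).card = n := by
  rw [aliasWindow, Int.card_Icc]
  omega

theorem aliasIndex_mem_aliasWindow (j : ℤ) : aliasIndex n j ∈ aliasWindow n := by
  have h_nonneg := Int.emod_nonneg (j + ((n - 1) / 2 : ℕ)) (b := n) (by omega)
  have h_lt := Int.emod_lt_of_pos (j + ((n - 1) / 2 : ℕ)) (b := n) (by omega)
  rw [aliasWindow, Finset.mem_Icc, aliasIndex]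
  omega

theorem two_mul_abs_aliasIndex_le (j : ℤ) : 2 * |aliasIndex n j| ≤ n :=
  two_mul_abs_le_of_mem_aliasWindow (aliasIndex_mem_aliasWindow hn j)

theorem aliasIndex_eq_iff {i : ℤ} (hi : i ∈ aliasWindow n) (j : ℤ) :
    aliasIndex n j = i ↔ (n : ℤ) ∣ j - i := by
  refine ⟨fun h => h ▸ dvd_sub_aliasIndex n j, fun h => sub_eq_zero.mp ?_⟩
  have h_mem := aliasIndex_mem_aliasWindow hn j
  rw [aliasWindow, Finset.mem_Icc] at hi h_mem
  refine Int.eq_zero_of_abs_lt_dvd (m := n) ?_ (by rw [abs_lt]; omega)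
  simpa only [sub_sub_sub_cancel_left] using dvd_sub h (dvd_sub_aliasIndex n j)

theorem le_two_mul_abs_of_aliasIndex_ne {j : ℤ} (h : aliasIndex n j ≠ j) : (n : ℤ) ≤ 2 * |j| := by
  by_contra! h_lt
  refine h ((aliasIndex_eq_iff hn (Finset.mem_Icc.mpr ?_) j).mpr (by simp))
  rcases abs_cases j with h_abs | h_abs <;> omega

theorem abs_aliasIndex_sub_le (j : ℤ) : |aliasIndex n j - j| ≤ 2 * |j| := by
  rcases eq_or_ne (aliasIndex n j) j with h | h
  · rw [h, sub_self, abs_zero]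
    positivity
  have h_alias := two_mul_abs_aliasIndex_le hn j
  have h_le := le_two_mul_abs_of_aliasIndex_ne hn h
  have h_sub := abs_sub (aliasIndex n j) j
  omega

theorem average_exp_zpow_nodes (m : ℤ) :
    (1 / n : ℂ) * ∑ l ∈ Finset.range n, exp ((2 * Real.pi * l / n : ℝ) * I) ^ m =
      if (n : ℤ) ∣ m then 1 else 0 := by
  have hn' : (n : ℂ) ≠ 0 := by exact_mod_cast hn
  have h_root := Complex.isPrimitiveRoot_exp n hn
  set ω := exp (2 * Real.pi * I / n) with hω
  have h_node : ∀ l : ℕ, exp ((2 * Real.pi * l / n : ℝ) * I) ^ m = (ω ^ m) ^ l := fun l => by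
    rw [← zpow_natCast, zpow_comm, zpow_natCast, hω, ← Complex.exp_nat_mul]
    congr 2
    push_cast
    ring
  simp only [h_node]
  split_ifs with h
  · simp [(h_root.zpow_eq_one_iff_dvd m).mpr h, hn']
  · have h_ne : ω ^ m ≠ 1 := fun h_one => h ((h_root.zpow_eq_one_iff_dvd m).mp h_one)
    rw [geom_sum_eq h_ne, ← zpow_natCast, zpow_comm, zpow_natCast, h_root.pow_eq_one, one_zpow,
      sub_self, zero_div, mul_zero]

theorem hasSum_discreteCoeff {F : ℝ → ℂ} {a : ℤ → ℂ}
    (hF : ∀ θ : ℝ, HasSum (fun j : ℤ => a j * exp (θ * I) ^ j) (F θ)) (i : ℤ) :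
    HasSum (fun j : ℤ => a j * if (n : ℤ) ∣ j - i then 1 else 0) (discreteCoeff n F i) := by
  have h_shift : ∀ (θ : ℝ) (j : ℤ), exp (-(I * i * θ)) * (a j * exp (θ * I) ^ j) =
      a j * exp (θ * I) ^ (j - i) := fun θ j => by
    rw [mul_left_comm, sub_eq_neg_add, zpow_add₀ (Complex.exp_ne_zero _),
      ← Complex.exp_int_mul _ (-i)]
    congr 3
    push_cast
    ring
  have h_sum := (hasSum_sum (s := Finset.range n) fun l _ =>
    (hF (2 * Real.pi * l / n)).mul_left (exp (-(I * i * (2 * Real.pi * l / n : ℝ))))).mul_left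
      (1 / n : ℂ)
  refine h_sum.congr_fun fun j => ?_
  simp only [h_shift, ← Finset.mul_sum, ← average_exp_zpow_nodes hn]
  ring

theorem hasSum_ratInterp {β : ℝ} {f : ℝ → ℂ} {a : ℤ → ℂ}
    (ha : ∀ θ : ℝ, HasSum (fun j : ℤ => a j * exp (θ * I) ^ j) (pullback β f θ)) (x : ℝ) :
    HasSum (fun j : ℤ => a j * moebius β x ^ aliasIndex n j) (ratInterp β n f x) := by
  have h_sum := hasSum_sum (s := aliasWindow n) fun i _ =>
    (hasSum_discreteCoeff hn ha i).mul_right (moebius β x ^ i)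
  refine h_sum.congr_fun fun j => ?_
  rw [Finset.sum_eq_single_of_mem _ (aliasIndex_mem_aliasWindow hn j) fun i hi h_ne => ?_,
    if_pos (dvd_sub_aliasIndex n j), mul_one]
  rw [if_neg fun h => h_ne ((aliasIndex_eq_iff hn hi j).mpr h).symm, mul_zero, zero_mul]

end Aliasing

section SeriesInLp

variable {α ι E : Type*} [MeasurableSpace α] {μ : Measure α} [Countable ι] [NormedAddCommGroup E]
  {p : ℝ≥0∞} {T : ι → α → E} {g : α → E}

theorem eLpNorm_le_tsum_of_hasSum (hp : 1 ≤ p) (hT : ∀ i, AEStronglyMeasurable (T i) μ)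
    (hg : ∀ᵐ x ∂μ, HasSum (fun i => T i x) (g x)) :
    eLpNorm g p μ ≤ ∑' i, eLpNorm (T i) p μ := by
  refine Lp.eLpNorm_le_of_ae_tendsto (u := atTop) (f := fun S : Finset ι => ∑ i ∈ S, T i)
    (.of_forall fun S => ?_) (fun S => Finset.aestronglyMeasurable_sum S fun i _ => hT i) ?_
  · exact (eLpNorm_sum_le (fun i _ => hT i) hp).trans (ENNReal.sum_le_tsum S)
  · simpa only [Finset.sum_apply, HasSum, SummationFilter.unconditional_filter] using hg

theorem tendsto_eLpNorm_sum_sub_of_hasSum (hp : 1 ≤ p) (hT : ∀ i, AEStronglyMeasurable (T i) μ)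
    (hg : ∀ᵐ x ∂μ, HasSum (fun i => T i x) (g x)) (hsum : ∑' i, eLpNorm (T i) p μ ≠ ∞) :
    Tendsto (fun S : Finset ι => eLpNorm ((fun x => ∑ i ∈ S, T i x) - g) p μ) atTop (𝓝 0) := by
  refine tendsto_of_tendsto_of_tendsto_of_le_of_le tendsto_const_nhds
    (ENNReal.tendsto_tsum_compl_atTop_zero hsum) (fun _ => zero_le) fun S => ?_
  rw [eLpNorm_sub_comm]
  refine eLpNorm_le_tsum_of_hasSum hp (fun i => hT i) ?_
  filter_upwards [hg] with x hx
  rw [Finset.hasSum_compl_iff S (f := fun i => T i x), Pi.sub_apply, sub_add_cancel]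
  exact hx

end SeriesInLp

section WeightedCoefficients

/-- The squared norm `∑ⱼ (1 + |j|)^{2s} |aⱼ|²` of the weighted `ℓ²` space of Fourier coefficients of
`H^s(𝕋)`; it is `0` if the series diverges. -/
def weightedSum (s : ℝ) (a : ℤ → ℂ) : ℝ :=
  ∑' j : ℤ, (1 + |(j : ℝ)|) ^ (2 * s) * ‖a j‖ ^ 2

/-- The value `2 ζ(b)` of `∑ |m|^{-b}` over the nonzero integers. -/
def intZeta (b : ℝ) : ℝ :=
  ∑' m : ℤ, |(m : ℝ)| ^ (-b)

theorem weightedSum_nonneg (s : ℝ) (a : ℤ → ℂ) : 0 ≤ weightedSum s a :=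
  tsum_nonneg fun _ => by positivity

theorem intZeta_nonneg (b : ℝ) : 0 ≤ intZeta b :=
  tsum_nonneg fun _ => by positivity

theorem MemPeriodicSobolev.summable_weight {s : ℝ} {F : ℝ → ℂ} (hF : MemPeriodicSobolev s F) :
    Summable fun j : ℤ => (1 + |(j : ℝ)|) ^ (2 * s) * ‖periodicCoeff F j‖ ^ 2 := by
  have h_ne_top := ((ENNReal.rpow_lt_top_iff_of_pos (by norm_num)).mp hF.2).ne
  refine (ENNReal.summable_toReal h_ne_top).congr fun j => ?_
  rw [ENNReal.toReal_ofReal (by positivity)]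

theorem MemPeriodicSobolev.periodicSobolevNorm_eq {s : ℝ} {F : ℝ → ℂ}
    (hF : MemPeriodicSobolev s F) :
    periodicSobolevNorm s F = ENNReal.ofReal √(weightedSum s (periodicCoeff F)) := by
  rw [periodicSobolevNorm, ← ENNReal.ofReal_tsum_of_nonneg (fun j => by positivity)
    hF.summable_weight, Real.sqrt_eq_rpow,
    ← ENNReal.ofReal_rpow_of_nonneg (weightedSum_nonneg _ _) (by norm_num), weightedSum]

theorem half_mul_abs_le_abs {n : ℕ} {i j m : ℤ} (hi : 2 * |i| ≤ n) (hm : m ≠ 0)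
    (hj : j - i = n * m) : (n : ℝ) / 2 * |(m : ℝ)| ≤ |(j : ℝ)| := by
  have h_int : (n : ℤ) * |m| ≤ 2 * |j| := by
    have h_one : 1 ≤ |m| := Int.one_le_abs hm
    have h_sub : |j - i| ≤ |j| + |i| := abs_sub j i
    rw [hj, abs_mul, Nat.abs_cast] at h_sub
    nlinarith
  have h_real : (n : ℝ) * |(m : ℝ)| ≤ 2 * |(j : ℝ)| := by exact_mod_cast h_int
  linarith

theorem sum_one_add_abs_rpow_le_of_dvd_sub {b : ℝ} (hb : 1 < b) {n : ℕ} (hn : n ≠ 0) {i : ℤ}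
    (hi : 2 * |i| ≤ n) (S : Finset ℤ) (hS : ∀ j ∈ S, (n : ℤ) ∣ j - i ∧ j ≠ i) :
    ∑ j ∈ S, (1 + |(j : ℝ)|) ^ (-b) ≤ ((n : ℝ) / 2) ^ (-b) * intZeta b := by
  have h_quot : ∀ j ∈ S, j - i = n * ((j - i) / n) := fun j hj =>
    (Int.mul_ediv_cancel' (hS j hj).1).symm
  have h_inj : Set.InjOn (fun j : ℤ => (j - i) / n) S := fun j hj l hl (h_eq : _ / _ = _ / _) => by
    have h_sub := h_quot j hj
    rw [h_eq, ← h_quot l hl] at h_sub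
    exact sub_left_injective h_sub
  have h_term : ∀ j ∈ S, (1 + |(j : ℝ)|) ^ (-b) ≤
      ((n : ℝ) / 2) ^ (-b) * |(((j - i) / n : ℤ) : ℝ)| ^ (-b) := fun j hj => by
    have hm : (j - i) / n ≠ 0 := fun h_zero => (hS j hj).2 <| by
      rw [← sub_eq_zero, h_quot j hj, h_zero, mul_zero]
    have h_abs : 0 < |(((j - i) / n : ℤ) : ℝ)| := abs_pos.mpr (Int.cast_ne_zero.mpr hm)
    rw [← Real.mul_rpow (by positivity) h_abs.le]
    refine Real.rpow_le_rpow_of_nonpos (by positivity) ?_ (by linarith)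
    linarith [half_mul_abs_le_abs hi hm (h_quot j hj)]
  refine (Finset.sum_le_sum h_term).trans ?_
  rw [← Finset.mul_sum, ← Finset.sum_image (f := fun m : ℤ => |(m : ℝ)| ^ (-b)) h_inj]
  gcongr
  exact (Real.summable_abs_int_rpow hb).sum_le_tsum _ fun _ _ => by positivity

theorem one_add_abs_rpow_le {n : ℕ} (hn : n ≠ 0) {j : ℤ} (hj : (n : ℤ) ≤ 2 * |j|) {t : ℝ}
    (ht : t ≤ 0) : (1 + |(j : ℝ)|) ^ t ≤ ((n : ℝ) / 2) ^ t := by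
  have hj' : (n : ℝ) ≤ 2 * |(j : ℝ)| := by exact_mod_cast hj
  exact Real.rpow_le_rpow_of_nonpos (by positivity) (by linarith) ht

theorem sum_mul_norm_sq_le (s : ℝ) (a : ℤ → ℂ) (d : ℤ → ℝ) (S : Finset ℤ) :
    (∑ j ∈ S, d j * ‖a j‖) ^ 2 ≤ (∑ j ∈ S, d j ^ 2 * (1 + |(j : ℝ)|) ^ (-(2 * s))) *
      ∑ j ∈ S, (1 + |(j : ℝ)|) ^ (2 * s) * ‖a j‖ ^ 2 := by
  refine Finset.sum_sq_le_sum_mul_sum_of_sq_le_mul S (fun j _ => by positivity)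
    (fun j _ => by positivity) fun j _ => Eq.le ?_
  rw [← mul_assoc, mul_assoc (d j ^ 2), ← Real.rpow_add (by positivity), neg_add_cancel,
    Real.rpow_zero, mul_one, mul_pow]

theorem sum_fiber_one_add_abs_rpow_le {b : ℝ} (hb : 1 < b) {n : ℕ} (hn : n ≠ 0) (S : Finset ℤ)
    (hS : ∀ j ∈ S, aliasIndex n j ≠ j) {i : ℤ} (hi : i ∈ aliasWindow n) :
    ∑ j ∈ S with aliasIndex n j = i, (1 + |(j : ℝ)|) ^ (-b) ≤
      ((n : ℝ) / 2) ^ (-b) * intZeta b := by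
  refine sum_one_add_abs_rpow_le_of_dvd_sub hb hn (two_mul_abs_le_of_mem_aliasWindow hi) _
    fun j hj => ?_
  obtain ⟨hjS, rfl⟩ := Finset.mem_filter.mp hj
  exact ⟨dvd_sub_aliasIndex n j, (hS j hjS).symm⟩

theorem sum_aliased_one_add_abs_rpow_le {b : ℝ} (hb : 1 < b) {n : ℕ} (hn : n ≠ 0) (S : Finset ℤ)
    (hS : ∀ j ∈ S, aliasIndex n j ≠ j) :
    ∑ j ∈ S, (1 + |(j : ℝ)|) ^ (-b) ≤ n * (((n : ℝ) / 2) ^ (-b) * intZeta b) := by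
  rw [← Finset.sum_fiberwise_of_maps_to fun j _ => aliasIndex_mem_aliasWindow hn j]
  refine (Finset.sum_le_card_nsmul _ _ _ fun i hi =>
    sum_fiber_one_add_abs_rpow_le hb hn S hS hi).trans_eq ?_
  rw [card_aliasWindow hn, nsmul_eq_mul]

variable {s : ℝ} {a : ℤ → ℂ}
  (ha : Summable fun j : ℤ => (1 + |(j : ℝ)|) ^ (2 * s) * ‖a j‖ ^ 2)
include ha

theorem sum_weight_le (S : Finset ℤ) :
    ∑ j ∈ S, (1 + |(j : ℝ)|) ^ (2 * s) * ‖a j‖ ^ 2 ≤ weightedSum s a :=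
  ha.sum_le_tsum S fun _ _ => by positivity

theorem summable_of_summable_weight (hs : 1 / 2 < s) : Summable a := by
  refine .of_norm_bounded_eventually
    ((Real.summable_abs_int_rpow (b := 2 * s) (by linarith)).add ha) ?_
  filter_upwards [(Set.finite_singleton (0 : ℤ)).compl_mem_cofinite] with j hj
  have h_abs : 0 < |(j : ℝ)| := abs_pos.mpr (by exact_mod_cast hj)
  set t := (1 + |(j : ℝ)|) ^ (2 * s)
  have ht_pos : 0 < t := by positivity
  have h_inv : t⁻¹ ≤ |(j : ℝ)| ^ (-(2 * s)) := by
    rw [Real.rpow_neg h_abs.le]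
    exact inv_anti₀ (by positivity) (Real.rpow_le_rpow h_abs.le (by linarith) (by linarith))
  have h_am_gm : ‖a j‖ ≤ t⁻¹ + t * ‖a j‖ ^ 2 := by
    rw [← sub_nonneg]
    have h_factor : t⁻¹ + t * ‖a j‖ ^ 2 - ‖a j‖ = t⁻¹ * (1 + (t * ‖a j‖) ^ 2 - t * ‖a j‖) := by
      field_simp
    rw [h_factor]
    refine mul_nonneg (inv_nonneg.mpr ht_pos.le) ?_
    nlinarith [sq_nonneg (t * ‖a j‖ - 1), sq_nonneg (t * ‖a j‖)]
  linarith

variable (hs : 1 < s) {n : ℕ} (hn : n ≠ 0) (S : Finset ℤ)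
  (hS : ∀ j ∈ S, aliasIndex n j ≠ j)
include hs hn hS

theorem sum_sqrt_abs_mul_norm_sq_le :
    (∑ j ∈ S, √|(j : ℝ)| * ‖a j‖) ^ 2 ≤
      2 * intZeta (2 * s - 1) * (((n : ℝ) / 2) ^ (2 * (1 - s)) * weightedSum s a) := by
  have h_weight : ∀ j : ℤ, √|(j : ℝ)| ^ 2 * (1 + |(j : ℝ)|) ^ (-(2 * s)) ≤
      (1 + |(j : ℝ)|) ^ (-(2 * s - 1)) := fun j => by
    have hj : 0 < 1 + |(j : ℝ)| := by positivity
    rw [Real.sq_sqrt (abs_nonneg _), neg_sub, sub_eq_add_neg, Real.rpow_add hj, Real.rpow_one]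
    gcongr
    linarith
  have h_pow : (n : ℝ) * ((n : ℝ) / 2) ^ (-(2 * s - 1)) = 2 * ((n : ℝ) / 2) ^ (2 * (1 - s)) := by
    have h_exp : 2 * (1 - s) = -(2 * s - 1) + 1 := by ring
    rw [h_exp, Real.rpow_add_one (by positivity)]
    ring
  calc (∑ j ∈ S, √|(j : ℝ)| * ‖a j‖) ^ 2
    _ ≤ (∑ j ∈ S, √|(j : ℝ)| ^ 2 * (1 + |(j : ℝ)|) ^ (-(2 * s))) *
          ∑ j ∈ S, (1 + |(j : ℝ)|) ^ (2 * s) * ‖a j‖ ^ 2 := sum_mul_norm_sq_le s a _ S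
    _ ≤ (n * (((n : ℝ) / 2) ^ (-(2 * s - 1)) * intZeta (2 * s - 1))) * weightedSum s a := by
      have h_zeta := intZeta_nonneg (2 * s - 1)
      exact mul_le_mul ((Finset.sum_le_sum fun j _ => h_weight j).trans
        (sum_aliased_one_add_abs_rpow_le (by linarith) hn S hS)) (sum_weight_le ha S)
        (by positivity) (by positivity)
    _ = 2 * intZeta (2 * s - 1) * (((n : ℝ) / 2) ^ (2 * (1 - s)) * weightedSum s a) := by
      linear_combination intZeta (2 * s - 1) * weightedSum s a * h_pow

theorem sum_norm_index_mul_sq_le :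
    ∑ j ∈ S, ‖(j : ℂ) * a j‖ ^ 2 ≤ ((n : ℝ) / 2) ^ (2 * (1 - s)) * weightedSum s a := by
  have h_term : ∀ j ∈ S, ‖(j : ℂ) * a j‖ ^ 2 ≤
      ((n : ℝ) / 2) ^ (2 * (1 - s)) * ((1 + |(j : ℝ)|) ^ (2 * s) * ‖a j‖ ^ 2) := fun j hj => by
    have hj_pos : 0 < 1 + |(j : ℝ)| := by positivity
    rw [norm_mul, mul_pow, Complex.norm_intCast, ← mul_assoc]
    gcongr
    calc |(j : ℝ)| ^ 2
      _ ≤ (1 + |(j : ℝ)|) ^ (2 : ℝ) := by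
        rw [Real.rpow_two]
        gcongr
        linarith
      _ = (1 + |(j : ℝ)|) ^ (2 * (1 - s)) * (1 + |(j : ℝ)|) ^ (2 * s) := by
        rw [← Real.rpow_add hj_pos]
        ring_nf
      _ ≤ ((n : ℝ) / 2) ^ (2 * (1 - s)) * (1 + |(j : ℝ)|) ^ (2 * s) := by
        refine mul_le_mul_of_nonneg_right ?_ (by positivity)
        exact one_add_abs_rpow_le hn (le_two_mul_abs_of_aliasIndex_ne hn (hS j hj)) (by linarith)
  refine (Finset.sum_le_sum h_term).trans ?_
  rw [← Finset.mul_sum]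
  gcongr
  exact sum_weight_le ha S

omit ha in
theorem norm_index_mul_sum_fiber_sq_le {i : ℤ} (hi : i ∈ aliasWindow n) :
    ‖(i : ℂ) * ∑ j ∈ S with aliasIndex n j = i, a j‖ ^ 2 ≤
      intZeta (2 * s) * ((n : ℝ) / 2) ^ (2 * (1 - s)) *
        ∑ j ∈ S with aliasIndex n j = i, (1 + |(j : ℝ)|) ^ (2 * s) * ‖a j‖ ^ 2 := by
  have h_index : |(i : ℝ)| ≤ (n : ℝ) / 2 := by
    have h_two : 2 * |(i : ℝ)| ≤ n := by exact_mod_cast two_mul_abs_le_of_mem_aliasWindow hi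
    linarith
  have h_pow : ((n : ℝ) / 2) ^ (2 * (1 - s)) = ((n : ℝ) / 2) ^ 2 * ((n : ℝ) / 2) ^ (-(2 * s)) := by
    rw [← Real.rpow_two, ← Real.rpow_add (by positivity)]
    ring_nf
  have h_sum : ‖∑ j ∈ S with aliasIndex n j = i, a j‖ ^ 2 ≤
      ((n : ℝ) / 2) ^ (-(2 * s)) * intZeta (2 * s) *
        ∑ j ∈ S with aliasIndex n j = i, (1 + |(j : ℝ)|) ^ (2 * s) * ‖a j‖ ^ 2 := by
    have h_cauchy := sum_mul_norm_sq_le s a (fun _ => 1) {j ∈ S | aliasIndex n j = i}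
    simp only [one_mul, one_pow] at h_cauchy
    refine (pow_le_pow_left₀ (norm_nonneg _) (norm_sum_le _ _) 2).trans (h_cauchy.trans ?_)
    gcongr
    exact sum_fiber_one_add_abs_rpow_le (by linarith) hn S hS hi
  rw [norm_mul, mul_pow, Complex.norm_intCast, h_pow, mul_assoc, mul_left_comm, mul_assoc]
  refine (mul_le_mul (pow_le_pow_left₀ (abs_nonneg _) h_index 2) h_sum (by positivity)
    (by positivity)).trans_eq ?_
  ring

theorem sum_norm_index_mul_sum_fiber_sq_le :
    ∑ i ∈ aliasWindow n, ‖(i : ℂ) * ∑ j ∈ S with aliasIndex n j = i, a j‖ ^ 2 ≤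
      intZeta (2 * s) * (((n : ℝ) / 2) ^ (2 * (1 - s)) * weightedSum s a) := by
  refine (Finset.sum_le_sum fun i hi => norm_index_mul_sum_fiber_sq_le hs hn S hS hi).trans ?_
  rw [← Finset.mul_sum, Finset.sum_fiberwise_of_maps_to fun j _ => aliasIndex_mem_aliasWindow hn j,
    mul_assoc]
  gcongr
  · exact intZeta_nonneg _
  · exact sum_weight_le ha S

end WeightedCoefficients

section InterpolationError

/-- The contribution `aⱼ (M^{alias j} - M^j)` of the frequency `j` to the interpolation error of
`∑ⱼ aⱼ M^j`. -/
def aliasingTerm (β : ℝ) (n : ℕ) (a : ℤ → ℂ) (j : ℤ) (x : ℝ) : ℂ :=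
  a j * (moebius β x ^ aliasIndex n j - moebius β x ^ j)

theorem aliasingTerm_eq_zero (β : ℝ) {n : ℕ} (a : ℤ → ℂ) {j : ℤ} (hj : aliasIndex n j = j) :
    aliasingTerm β n a j = 0 := by
  ext x
  rw [aliasingTerm, hj, sub_self, mul_zero, Pi.zero_apply]

theorem sum_filter_aliasingTerm (β : ℝ) (n : ℕ) (a : ℤ → ℂ) (S : Finset ℤ) (x : ℝ) :
    ∑ j ∈ S with aliasIndex n j ≠ j, aliasingTerm β n a j x = ∑ j ∈ S, aliasingTerm β n a j x :=
  Finset.sum_filter_of_ne fun _ _ h_ne h_eq => h_ne (by rw [aliasingTerm_eq_zero β a h_eq]; rfl)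

theorem continuous_aliasingTerm {β : ℝ} (hβ : β ≠ 0) (n : ℕ) (a : ℤ → ℂ) (j : ℤ) :
    Continuous (aliasingTerm β n a j) :=
  continuous_const.mul ((continuous_moebius_zpow hβ _).sub (continuous_moebius_zpow hβ j))

theorem aestronglyMeasurable_moebiusDensity_mul_sum {β : ℝ} (hβ : β ≠ 0) (S : Finset ℤ)
    (c : ℤ → ℂ) : AEStronglyMeasurable
      (fun x : ℝ => (moebiusDensity β x : ℂ) * ∑ i ∈ S, c i * moebius β x ^ i) volume :=
  ((continuous_ofReal.comp (continuous_moebiusDensity hβ)).mul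
    (continuous_finsetSum _ fun i _ =>
      continuous_const.mul (continuous_moebius_zpow hβ i))).aestronglyMeasurable

/-- The derivative of `∑ j ∈ S, aliasingTerm β n a j`, in which the aliased frequencies are grouped
by their common representative `i` so that each of the two sums is orthogonal. -/
def aliasingDeriv (β : ℝ) (n : ℕ) (a : ℤ → ℂ) (S : Finset ℤ) (x : ℝ) : ℂ :=
  I * (moebiusDensity β x * ∑ i ∈ aliasWindow n,
      (i * ∑ j ∈ S with aliasIndex n j = i, a j) * moebius β x ^ i -
    moebiusDensity β x * ∑ j ∈ S, j * a j * moebius β x ^ j)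

theorem aestronglyMeasurable_aliasingDeriv {β : ℝ} (hβ : β ≠ 0) (n : ℕ) (a : ℤ → ℂ)
    (S : Finset ℤ) : AEStronglyMeasurable (aliasingDeriv β n a S) volume :=
  ((aestronglyMeasurable_moebiusDensity_mul_sum hβ _ _).sub
    (aestronglyMeasurable_moebiusDensity_mul_sum hβ _ _)).const_mul I

theorem hasDerivAt_sum_aliasingTerm {β : ℝ} (hβ : β ≠ 0) {n : ℕ} (hn : n ≠ 0) (a : ℤ → ℂ)
    (S : Finset ℤ) (x : ℝ) :
    HasDerivAt (fun x => ∑ j ∈ S, aliasingTerm β n a j x) (aliasingDeriv β n a S x) x := by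
  have h_fiber : ∑ i ∈ aliasWindow n,
      (i * ∑ j ∈ S with aliasIndex n j = i, a j) * moebius β x ^ i =
        ∑ j ∈ S, aliasIndex n j * a j * moebius β x ^ aliasIndex n j := by
    rw [← Finset.sum_fiberwise_of_maps_to (s := S) fun j _ => aliasIndex_mem_aliasWindow hn j]
    refine Finset.sum_congr rfl fun i _ => ?_
    rw [Finset.mul_sum, Finset.sum_mul]
    refine Finset.sum_congr rfl fun j hj => ?_
    rw [(Finset.mem_filter.mp hj).2]
  refine (HasDerivAt.fun_sum fun j _ => ((hasDerivAt_moebius_zpow hβ (aliasIndex n j) x).sub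
    (hasDerivAt_moebius_zpow hβ j x)).const_mul (a j)).congr_deriv ?_
  rw [aliasingDeriv, h_fiber, ← mul_sub, ← Finset.sum_sub_distrib, Finset.mul_sum, Finset.mul_sum]
  refine Finset.sum_congr rfl fun j _ => ?_
  ring

variable {β : ℝ} (hβ : 0 < β) {n : ℕ} (hn : n ≠ 0)
include hβ hn

theorem eLpNorm_aliasingTerm_le (a : ℤ → ℂ) (j : ℤ) :
    eLpNorm (aliasingTerm β n a j) 2 ≤
      ENNReal.ofReal (√(16 * Real.pi * β) * (√|(j : ℝ)| * ‖a j‖)) := by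
  have h_index : |((aliasIndex n j - j : ℤ) : ℝ)| ≤ 2 * |(j : ℝ)| := by
    exact_mod_cast abs_aliasIndex_sub_le hn j
  have h_smul : aliasingTerm β n a j =
      a j • fun x : ℝ => moebius β x ^ aliasIndex n j - moebius β x ^ j := rfl
  rw [h_smul, eLpNorm_const_smul, ← ofReal_norm, ← mul_assoc, mul_comm _ ‖a j‖,
    ENNReal.ofReal_mul (norm_nonneg _), ← Real.sqrt_mul (by positivity)]
  gcongr
  refine (eLpNorm_moebius_zpow_sub_zpow_le hβ _ _).trans (ENNReal.ofReal_le_ofReal ?_)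
  refine Real.sqrt_le_sqrt ?_
  rw [← mul_rotate]
  nlinarith [mul_le_mul_of_nonneg_left h_index (by positivity : 0 ≤ 8 * Real.pi * β)]

theorem memLp_sum_aliasingTerm (a : ℤ → ℂ) (S : Finset ℤ) :
    MemLp (fun x => ∑ j ∈ S, aliasingTerm β n a j x) 2 :=
  memLp_finsetSum S fun j _ => ⟨(continuous_aliasingTerm hβ.ne' n a j).aestronglyMeasurable,
    (eLpNorm_aliasingTerm_le hβ hn a j).trans_lt ENNReal.ofReal_lt_top⟩

variable {s : ℝ} (hs : 1 < s) {a : ℤ → ℂ}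
  (ha : Summable fun j : ℤ => (1 + |(j : ℝ)|) ^ (2 * s) * ‖a j‖ ^ 2)
include hs ha

theorem tsum_eLpNorm_aliasingTerm_le :
    ∑' j, eLpNorm (aliasingTerm β n a j) 2 ≤
      ENNReal.ofReal √(16 * Real.pi * β * (2 * intZeta (2 * s - 1) *
        (((n : ℝ) / 2) ^ (2 * (1 - s)) * weightedSum s a))) := by
  refine ENNReal.summable.tsum_le_of_sum_le fun S => ?_
  have h_filter : ∑ j ∈ S with aliasIndex n j ≠ j, eLpNorm (aliasingTerm β n a j) 2 =
      ∑ j ∈ S, eLpNorm (aliasingTerm β n a j) 2 :=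
    Finset.sum_filter_of_ne fun _ _ h_ne h_eq =>
      h_ne (by rw [aliasingTerm_eq_zero β a h_eq, eLpNorm_zero])
  rw [← h_filter]
  refine (Finset.sum_le_sum fun j _ => eLpNorm_aliasingTerm_le hβ hn a j).trans ?_
  rw [← ENNReal.ofReal_sum_of_nonneg fun _ _ => by positivity, ← Finset.mul_sum,
    Real.sqrt_mul (x := 16 * Real.pi * β) (by positivity)]
  gcongr
  exact (le_abs_self _).trans (Real.abs_le_sqrt (sum_sqrt_abs_mul_norm_sq_le ha hs hn _
    fun j hj => (Finset.mem_filter.mp hj).2))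

theorem eLpNorm_aliasingDeriv_le (S : Finset ℤ) (hS : ∀ j ∈ S, aliasIndex n j ≠ j) :
    eLpNorm (aliasingDeriv β n a S) 2 ≤
      ENNReal.ofReal √(4 * Real.pi / β * (intZeta (2 * s) *
        (((n : ℝ) / 2) ^ (2 * (1 - s)) * weightedSum s a))) +
      ENNReal.ofReal √(4 * Real.pi / β *
        (((n : ℝ) / 2) ^ (2 * (1 - s)) * weightedSum s a)) := by
  have h_aliased := (eLpNorm_moebiusDensity_mul_sum_le hβ (aliasWindow n) _).trans
    (ENNReal.ofReal_le_ofReal (Real.sqrt_le_sqrt (mul_le_mul_of_nonneg_left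
      (sum_norm_index_mul_sum_fiber_sq_le ha hs hn S hS) (by positivity))))
  have h_tail := (eLpNorm_moebiusDensity_mul_sum_le hβ S _).trans
    (ENNReal.ofReal_le_ofReal (Real.sqrt_le_sqrt (mul_le_mul_of_nonneg_left
      (sum_norm_index_mul_sq_le ha hs hn S hS) (by positivity))))
  have h_smul : aliasingDeriv β n a S = I • ((fun x : ℝ => (moebiusDensity β x : ℂ) *
      ∑ i ∈ aliasWindow n, (i * ∑ j ∈ S with aliasIndex n j = i, a j) * moebius β x ^ i) -
        fun x : ℝ => moebiusDensity β x * ∑ j ∈ S, j * a j * moebius β x ^ j) := rfl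
  rw [h_smul, eLpNorm_const_smul, ← ofReal_norm, norm_I, ENNReal.ofReal_one, one_mul]
  exact (eLpNorm_sub_le (aestronglyMeasurable_moebiusDensity_mul_sum hβ.ne' _ _)
    (aestronglyMeasurable_moebiusDensity_mul_sum hβ.ne' _ _) one_le_two).trans
    (add_le_add h_aliased h_tail)

theorem sobolevNorm_sum_aliasingTerm_le (S : Finset ℤ) :
    sobolevNorm 1 (fun x => ∑ j ∈ S, aliasingTerm β n a j x) ≤
      ENNReal.ofReal (2 * Real.pi) *
        (ENNReal.ofReal √(16 * Real.pi * β * (2 * intZeta (2 * s - 1) *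
          (((n : ℝ) / 2) ^ (2 * (1 - s)) * weightedSum s a))) +
        (ENNReal.ofReal √(4 * Real.pi / β * (intZeta (2 * s) *
          (((n : ℝ) / 2) ^ (2 * (1 - s)) * weightedSum s a))) +
        ENNReal.ofReal √(4 * Real.pi / β *
          (((n : ℝ) / 2) ^ (2 * (1 - s)) * weightedSum s a)))) := by
  have h_mem := memLp_sum_aliasingTerm hβ hn a {j ∈ S | aliasIndex n j ≠ j}
  have h_hasDerivAt := hasDerivAt_sum_aliasingTerm hβ.ne' hn a {j ∈ S | aliasIndex n j ≠ j}
  have h_deriv := eLpNorm_aliasingDeriv_le hβ hn hs ha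
    {j ∈ S | aliasIndex n j ≠ j} fun j hj => (Finset.mem_filter.mp hj).2
  simp only [sum_filter_aliasingTerm] at h_mem h_hasDerivAt
  have h_sum : eLpNorm (fun x => ∑ j ∈ S, aliasingTerm β n a j x) 2 ≤
      ∑' j, eLpNorm (aliasingTerm β n a j) 2 := by
    simpa only [Finset.sum_fn] using (eLpNorm_sum_le (fun j _ =>
      (continuous_aliasingTerm hβ.ne' n a j).aestronglyMeasurable) one_le_two).trans
        (ENNReal.sum_le_tsum S)
  have h_le := sobolevNorm_one_le_of_hasDerivAt h_mem
    ⟨aestronglyMeasurable_aliasingDeriv hβ.ne' n a _, h_deriv.trans_lt (by finiteness)⟩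
    h_hasDerivAt
  exact h_le.trans (mul_le_mul_right (add_le_add
    (h_sum.trans (tsum_eLpNorm_aliasingTerm_le hβ hn hs ha)) h_deriv) _)

theorem memSobolevLine_of_hasSum_aliasingTerm {g : ℝ → ℂ}
    (hg : ∀ x, HasSum (fun j => aliasingTerm β n a j x) (g x)) :
    MemSobolevLine 1 g ∧
      eLpNorm g 2 ≤ ENNReal.ofReal √(16 * Real.pi * β * (2 * intZeta (2 * s - 1) *
        (((n : ℝ) / 2) ^ (2 * (1 - s)) * weightedSum s a))) ∧
      sobolevNorm 1 g ≤ ENNReal.ofReal (2 * Real.pi) *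
        (ENNReal.ofReal √(16 * Real.pi * β * (2 * intZeta (2 * s - 1) *
          (((n : ℝ) / 2) ^ (2 * (1 - s)) * weightedSum s a))) +
        (ENNReal.ofReal √(4 * Real.pi / β * (intZeta (2 * s) *
          (((n : ℝ) / 2) ^ (2 * (1 - s)) * weightedSum s a))) +
        ENNReal.ofReal √(4 * Real.pi / β *
          (((n : ℝ) / 2) ^ (2 * (1 - s)) * weightedSum s a)))) := by
  have h_meas := fun j => (continuous_aliasingTerm hβ.ne' n a j).aestronglyMeasurable (μ := volume)
  have h_tsum := tsum_eLpNorm_aliasingTerm_le hβ hn hs ha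
  have h_eLpNorm := (eLpNorm_le_tsum_of_hasSum one_le_two h_meas (.of_forall hg)).trans h_tsum
  have h_mem : MemLp g 2 := by
    refine ⟨?_, h_eLpNorm.trans_lt ENNReal.ofReal_lt_top⟩
    exact aestronglyMeasurable_of_tendsto_ae (atTop : Filter (Finset ℤ))
      (fun S => (memLp_sum_aliasingTerm hβ hn a S).1) (.of_forall hg)
  have h_sobolev := sobolevNorm_le_of_tendsto_eLpNorm (memLp_sum_aliasingTerm hβ hn a) h_mem
    (tendsto_eLpNorm_sum_sub_of_hasSum one_le_two h_meas (.of_forall hg)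
      (h_tsum.trans_lt ENNReal.ofReal_lt_top).ne)
    (sobolevNorm_sum_aliasingTerm_le hβ hn hs ha)
  exact ⟨⟨h_mem, h_sobolev.trans_lt (by finiteness)⟩, h_eLpNorm, h_sobolev⟩

omit hβ hn hs ha in
theorem sqrt_mul_half_rpow_mul {c : ℝ} (hc : 0 ≤ c) (n : ℕ) (t W : ℝ) :
    √(c * (((n : ℝ) / 2) ^ (2 * t) * W)) = √c * (1 / 2) ^ t * ((n : ℝ) ^ t * √W) := by
  have h_half : (n : ℝ) / 2 = 1 / 2 * n := by ring
  rw [Real.sqrt_mul hc, Real.sqrt_mul (by positivity), mul_comm 2 t,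
    Real.rpow_mul (by positivity), Real.rpow_two, Real.sqrt_sq (by positivity), h_half,
    Real.mul_rpow (by positivity) (by positivity)]
  ring

omit hn ha in
theorem exists_bound_of_hasSum_aliasingTerm : ∃ C : ℝ, 0 < C ∧ ∀ n : ℕ, n ≠ 0 → ∀ a : ℤ → ℂ,
    (Summable fun j : ℤ => (1 + |(j : ℝ)|) ^ (2 * s) * ‖a j‖ ^ 2) → ∀ g : ℝ → ℂ,
      (∀ x, HasSum (fun j => aliasingTerm β n a j x) (g x)) → MemSobolevLine 1 g ∧
        eLpNorm g 2 ≤ ENNReal.ofReal (C * ((n : ℝ) ^ (1 - s) * √(weightedSum s a))) ∧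
        sobolevNorm 1 g ≤ ENNReal.ofReal (C * ((n : ℝ) ^ (1 - s) * √(weightedSum s a))) := by
  have h_zeta := intZeta_nonneg (2 * s - 1)
  have h_zeta' := intZeta_nonneg (2 * s)
  set A := √(16 * Real.pi * β * (2 * intZeta (2 * s - 1))) * (1 / 2) ^ (1 - s) with hA
  set B := √(4 * Real.pi / β * intZeta (2 * s)) * (1 / 2) ^ (1 - s) with hB
  set D := √(4 * Real.pi / β) * (1 / 2) ^ (1 - s) with hD
  have : 0 < D := by positivity
  refine ⟨2 * Real.pi * (A + (B + D)), by positivity, fun n hn a ha g hg => ?_⟩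
  obtain ⟨h_mem, h_eLpNorm, h_sobolev⟩ := memSobolevLine_of_hasSum_aliasingTerm hβ hn hs ha hg
  rw [← mul_assoc (16 * Real.pi * β), sqrt_mul_half_rpow_mul (by positivity), ← hA]
    at h_eLpNorm h_sobolev
  rw [← mul_assoc (4 * Real.pi / β), sqrt_mul_half_rpow_mul (by positivity), ← hB,
    sqrt_mul_half_rpow_mul (by positivity), ← hD] at h_sobolev
  set r := (n : ℝ) ^ (1 - s) * √(weightedSum s a)
  have hr : 0 ≤ r := by positivity
  refine ⟨h_mem, h_eLpNorm.trans (ENNReal.ofReal_le_ofReal ?_), h_sobolev.trans_eq ?_⟩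
  · have h_pi : 1 ≤ 2 * Real.pi := by linarith [Real.two_le_pi]
    have hA_le : A ≤ A + (B + D) := le_add_of_nonneg_right (by positivity)
    exact mul_le_mul_of_nonneg_right (hA_le.trans (le_mul_of_one_le_left (by positivity) h_pi)) hr
  · rw [← ENNReal.ofReal_add (by positivity) (by positivity),
      ← ENNReal.ofReal_add (by positivity) (by positivity), ← ENNReal.ofReal_mul (by positivity)]
    ring_nf

omit hn ha in
theorem exists_ratInterp_bound : ∃ C : ℝ, 0 < C ∧ ∀ f : ℝ → ℂ, Continuous f →
    Tendsto f (cocompact ℝ) (𝓝 0) → MemPeriodicSobolev s (pullback β f) → ∀ n : ℕ, n ≠ 0 →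
      MemSobolevLine 1 (fun x => ratInterp β n f x - f x) ∧
      eLpNorm (fun x => ratInterp β n f x - f x) 2 ≤
        ENNReal.ofReal (C * (n : ℝ) ^ (1 - s)) * periodicSobolevNorm s (pullback β f) ∧
      sobolevNorm 1 (fun x => ratInterp β n f x - f x) ≤
        ENNReal.ofReal (C * (n : ℝ) ^ (1 - s)) * periodicSobolevNorm s (pullback β f) := by
  obtain ⟨C, hC, h⟩ := exists_bound_of_hasSum_aliasingTerm hβ hs
  refine ⟨C, hC, fun f hc h0 hF n hn => ?_⟩
  have h_summable := summable_of_summable_weight hF.summable_weight (by linarith)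
  rw [hF.periodicSobolevNorm_eq, ← ENNReal.ofReal_mul (by positivity), mul_assoc]
  refine h n hn _ hF.summable_weight _ fun x => ?_
  simpa only [aliasingTerm, mul_sub] using
    (hasSum_ratInterp hn (hasSum_periodicCoeff_pullback hβ.ne' hc h0 h_summable) x).sub
      (hasSum_periodicCoeff_mul_moebius_zpow hβ.ne' hc h0 h_summable x)

end InterpolationError

section LineError

theorem ratInterp_one (β : ℝ) (f : ℝ → ℂ) (x : ℝ) : ratInterp β 1 f x = 0 := by
  simp [ratInterp, discreteCoeff, pullback]

variable {β s : ℝ} {f : ℝ → ℂ}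

theorem MemSobolevLine.of_ratInterp_one_sub
    (h : MemSobolevLine s fun x => ratInterp β 1 f x - f x) : MemSobolevLine s f := by
  have h_neg : f = -fun x => ratInterp β 1 f x - f x := by
    ext x
    rw [Pi.neg_apply, ratInterp_one, zero_sub, neg_neg]
  rw [h_neg]
  exact h.neg

variable {n : ℕ}

theorem MemSobolevLine.ratInterp_of_sub (hf : MemSobolevLine s f)
    (h : MemSobolevLine s fun x => ratInterp β n f x - f x) :
    MemSobolevLine s (ratInterp β n f) := by
  have h_sub : ratInterp β n f = (fun x => ratInterp β n f x - f x) - -f := by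
    ext x
    rw [Pi.sub_apply, Pi.neg_apply, sub_neg_eq_add, sub_add_cancel]
  rw [h_sub]
  exact h.sub hf.neg

theorem sub_ratInterp_eq_neg (β : ℝ) (n : ℕ) (f : ℝ → ℂ) :
    f - ratInterp β n f = -fun x => ratInterp β n f x - f x :=
  (neg_sub (ratInterp β n f) f).symm

variable (hf : MemSobolevLine 1 f) (hR : MemSobolevLine 1 (ratInterp β n f)) (k : ℝ) (σ : ℤˣ)
  {δ : ℝ} (hδ : 0 ≤ δ)
include hf hR hδ

theorem lineError_eq :
    lineError β k n f σ δ = lineTrace σ δ (oscCauchy k (f - ratInterp β n f)) :=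
  (lineTrace_oscCauchy_sub hf hR hδ).symm

theorem sobolevNorm_lineError_le : sobolevNorm 1 (lineError β k n f σ δ) ≤
    ENNReal.ofReal (1 + |k|) * sobolevNorm 1 (fun x => ratInterp β n f x - f x) := by
  have h_le := sobolevNorm_lineTrace_oscCauchy_le (k := k) (σ := σ) (hf.sub hR) zero_le_one hδ
  rwa [Real.rpow_one, sub_ratInterp_eq_neg, sobolevNorm_neg, ← sub_ratInterp_eq_neg,
    ← lineError_eq hf hR k σ hδ] at h_le

theorem eLpNorm_lineError_le : eLpNorm (lineError β k n f σ δ) 2 ≤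
    eLpNorm (fun x => ratInterp β n f x - f x) 2 := by
  have h_le := eLpNorm_lineTrace_oscCauchy_le (k := k) (σ := σ) (hf.sub hR) hδ
  rwa [sub_ratInterp_eq_neg, eLpNorm_neg, ← sub_ratInterp_eq_neg,
    ← lineError_eq hf hR k σ hδ] at h_le

theorem iSup_enorm_lineError_le :
    ⨆ x, ‖lineError β k n f σ δ x‖ₑ ≤ sobolevNorm 1 (lineError β k n f σ 0) := by
  rw [lineError_eq hf hR k σ hδ, lineError_eq hf hR k σ le_rfl]
  exact iSup_le (enorm_lineTrace_oscCauchy_le (hf.sub hR) hδ)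

theorem iSup_enorm_lineError_le_interpolation : ⨆ x, ‖lineError β k n f σ δ x‖ₑ ≤
    ENNReal.ofReal (1 + |k|) * sobolevNorm 1 (fun x => ratInterp β n f x - f x) :=
  (iSup_enorm_lineError_le hf hR k σ hδ).trans (sobolevNorm_lineError_le hf hR k σ le_rfl)

end LineError

section Rate

theorem exists_memSobolevLine_ratInterp_bound {β s r : ℝ} (hβ : 0 < β) (hs : 1 < s)
    (hr : 1 - s ≤ r) : ∃ C : ℝ, 0 < C ∧ ∀ f : ℝ → ℂ, Continuous f →
      Tendsto f (cocompact ℝ) (𝓝 0) → MemPeriodicSobolev s (pullback β f) →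
        MemSobolevLine 1 f ∧ ∀ n : ℕ, 1 ≤ n → MemSobolevLine 1 (ratInterp β n f) ∧
          eLpNorm (fun x => ratInterp β n f x - f x) 2 ≤
            ENNReal.ofReal (C * (n : ℝ) ^ r) * periodicSobolevNorm s (pullback β f) ∧
          sobolevNorm 1 (fun x => ratInterp β n f x - f x) ≤
            ENNReal.ofReal (C * (n : ℝ) ^ r) * periodicSobolevNorm s (pullback β f) := by
  obtain ⟨C, hC, h⟩ := exists_ratInterp_bound hβ hs
  refine ⟨C, hC, fun f hc h0 hF => ?_⟩
  have hf : MemSobolevLine 1 f := .of_ratInterp_one_sub (h f hc h0 hF 1 one_ne_zero).1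
  refine ⟨hf, fun n hn => ?_⟩
  obtain ⟨h_mem, h_eLpNorm, h_sobolev⟩ := h f hc h0 hF n (Nat.one_le_iff_ne_zero.mp hn)
  have h_rate : ENNReal.ofReal (C * (n : ℝ) ^ (1 - s)) ≤ ENNReal.ofReal (C * (n : ℝ) ^ r) := by
    have hn' : (1 : ℝ) ≤ n := mod_cast hn
    gcongr
  exact ⟨hf.ratInterp_of_sub h_mem, h_eLpNorm.trans (mul_le_mul_left h_rate _),
    h_sobolev.trans (mul_le_mul_left h_rate _)⟩

theorem tendsto_ofReal_mul_rpow_mul {r : ℝ} (hr : r < 0) (c : ℝ) {N : ℝ≥0∞} (hN : N ≠ ∞) :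
    Tendsto (fun n : ℕ => ENNReal.ofReal (c * (n : ℝ) ^ r) * N) atTop (𝓝 0) := by
  have h_rpow : Tendsto (fun n : ℕ => (n : ℝ) ^ r) atTop (𝓝 0) := by
    rw [← neg_neg r]
    exact (tendsto_rpow_neg_atTop (neg_pos.mpr hr)).comp tendsto_natCast_atTop_atTop
  have h_ofReal := ENNReal.tendsto_ofReal (h_rpow.const_mul c)
  simpa only [mul_zero, ENNReal.ofReal_zero, zero_mul] using
    ENNReal.Tendsto.mul_const h_ofReal (Or.inr hN)

end Rate

end OscCauchy

end

open MeasureTheory Filter Topology OscCauchy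

theorem mainTheorem4_general (β : ℝ) (hβ : 0 < β) (ε s : ℝ) (hε : 0 ≤ ε) (hs : 1 + ε < s) :
    ∃ C : ℝ, 0 < C ∧ ∀ f : ℝ → ℂ, Continuous f → Tendsto f (cocompact ℝ) (𝓝 0) →
      MemPeriodicSobolev s (pullback β f) → ∀ k : ℝ,
      ((∀ z : ℂ, z.im ≠ 0 → Integrable (cauchyIntegrand k f z)) ∧
        (∀ n : ℕ, 1 ≤ n → ∀ z : ℂ, z.im ≠ 0 →
          Integrable (cauchyIntegrand k (ratInterp β n f) z)) ∧
        (∀ (σ : ℤˣ) (x : ℝ),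
          Tendsto (fun η : ℝ => oscCauchy k f (x + ((σ : ℤ) : ℂ) * η * Complex.I))
            (𝓝[>] 0) (𝓝 (boundaryValue σ (oscCauchy k f) x))) ∧
        (∀ n : ℕ, 1 ≤ n → ∀ (σ : ℤˣ) (x : ℝ),
          Tendsto (fun η : ℝ => oscCauchyApprox β k n f (x + ((σ : ℤ) : ℂ) * η * Complex.I))
            (𝓝[>] 0) (𝓝 (boundaryValue σ (oscCauchyApprox β k n f) x)))) ∧
      (∀ n : ℕ, 1 ≤ n → ∀ (σ : ℤˣ) (δ : ℝ), 0 ≤ δ →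
        (sobolevNorm 1 (lineError β k n f σ δ) ≤
            ENNReal.ofReal (1 + |k|) * sobolevNorm 1 (fun x => ratInterp β n f x - f x) ∧
          ENNReal.ofReal (1 + |k|) * sobolevNorm 1 (fun x => ratInterp β n f x - f x) ≤
            ENNReal.ofReal (C * (1 + |k|) * (n : ℝ) ^ (1 + ε - s)) *
              periodicSobolevNorm s (pullback β f)) ∧
        (eLpNorm (lineError β k n f σ δ) 2 volume ≤
            eLpNorm (fun x => ratInterp β n f x - f x) 2 volume ∧
          eLpNorm (fun x => ratInterp β n f x - f x) 2 volume ≤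
            ENNReal.ofReal (C * (n : ℝ) ^ (1 + ε - s)) *
              periodicSobolevNorm s (pullback β f)) ∧
        ((⨆ x : ℝ, ‖lineError β k n f σ δ x‖ₑ) ≤ sobolevNorm 1 (lineError β k n f σ 0) ∧
          (⨆ x : ℝ, ‖lineError β k n f σ δ x‖ₑ) ≤
            ENNReal.ofReal (C * (1 + |k|) * (n : ℝ) ^ (1 + ε - s)) *
              periodicSobolevNorm s (pullback β f))) ∧
      TendstoUniformlyOn (fun (n : ℕ) (z : ℂ) => oscCauchyApprox β k n f z) (oscCauchy k f)
          atTop {z : ℂ | z.im ≠ 0} ∧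
      ∀ σ : ℤˣ, TendstoUniformly
        (fun (n : ℕ) (x : ℝ) => boundaryValue σ (oscCauchyApprox β k n f) x)
        (boundaryValue σ (oscCauchy k f)) atTop := by
  obtain ⟨C, hC, h_interp⟩ := exists_memSobolevLine_ratInterp_bound hβ
    (by linarith : 1 < s) (by linarith : 1 - s ≤ 1 + ε - s)
  refine ⟨C, hC, fun f hc h0 hF k => ?_⟩
  obtain ⟨hf, h_interp⟩ := h_interp f hc h0 hF
  choose! hR h_L2 h_H1 using h_interp
  replace h_H1 : ∀ n : ℕ, 1 ≤ n →
      ENNReal.ofReal (1 + |k|) * sobolevNorm 1 (fun x => ratInterp β n f x - f x) ≤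
        ENNReal.ofReal (C * (1 + |k|) * (n : ℝ) ^ (1 + ε - s)) *
          periodicSobolevNorm s (pullback β f) := by
    intro n hn
    rw [mul_comm C, mul_assoc (1 + |k|), ENNReal.ofReal_mul (by positivity), mul_assoc]
    exact mul_le_mul_right (h_H1 n hn) _
  have h_sup n (hn : 1 ≤ n) (σ : ℤˣ) (δ : ℝ) (hδ : 0 ≤ δ) :=
    (iSup_enorm_lineError_le_interpolation hf (hR n hn) k σ hδ).trans (h_H1 n hn)
  have h_lim := tendsto_ofReal_mul_rpow_mul (by linarith : 1 + ε - s < 0) (C * (1 + |k|)) hF.2.ne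
  exact ⟨⟨fun _ => integrable_cauchyIntegrand hf.1 k,
      fun n hn _ => integrable_cauchyIntegrand (hR n hn).1 k,
      tendsto_oscCauchy hf k, fun n hn => tendsto_oscCauchy (hR n hn) k⟩,
    fun n hn σ δ hδ => ⟨⟨sobolevNorm_lineError_le hf (hR n hn) k σ hδ, h_H1 n hn⟩,
      ⟨eLpNorm_lineError_le hf (hR n hn) k σ hδ, h_L2 n hn⟩,
      iSup_enorm_lineError_le hf (hR n hn) k σ hδ, h_sup n hn σ δ hδ⟩,
    tendstoUniformlyOn_of_lineTrace h_lim ((eventually_ge_atTop 1).mono h_sup),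
    fun σ => tendstoUniformly_boundaryValue_of_lineTrace h_lim
      ((eventually_ge_atTop 1).mono fun n hn => h_sup n hn σ 0 le_rfl)⟩

theorem mainTheorem4 (β : ℝ) (hβ : 0 < β) (ε s : ℝ) (hε : 0 < ε) (hs : 1 + ε < s) :
    ∃ C : ℝ, 0 < C ∧ ∀ f : ℝ → ℂ, Continuous f → MemSobolevLine 1 f →
      MemPeriodicSobolev s (pullback β f) → ∀ k : ℝ,
      -- the Cauchy integrals converge and have boundary values
      ((∀ z : ℂ, z.im ≠ 0 → Integrable (cauchyIntegrand k f z)) ∧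
        (∀ n : ℕ, 1 ≤ n → ∀ z : ℂ, z.im ≠ 0 →
          Integrable (cauchyIntegrand k (ratInterp β n f) z)) ∧
        (∀ (σ : ℤˣ) (x : ℝ),
          Tendsto (fun η : ℝ => oscCauchy k f (x + ((σ : ℤ) : ℂ) * η * Complex.I))
            (𝓝[>] 0) (𝓝 (boundaryValue σ (oscCauchy k f) x))) ∧
        (∀ n : ℕ, 1 ≤ n → ∀ (σ : ℤˣ) (x : ℝ),
          Tendsto (fun η : ℝ => oscCauchyApprox β k n f (x + ((σ : ℤ) : ℂ) * η * Complex.I))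
            (𝓝[>] 0) (𝓝 (boundaryValue σ (oscCauchyApprox β k n f) x)))) ∧
      -- the error bounds, uniform in `δ ≥ 0`
      (∀ n : ℕ, 1 ≤ n → ∀ (σ : ℤˣ) (δ : ℝ), 0 ≤ δ →
        (sobolevNorm 1 (lineError β k n f σ δ) ≤
            ENNReal.ofReal (1 + |k|) * sobolevNorm 1 (fun x => ratInterp β n f x - f x) ∧
          ENNReal.ofReal (1 + |k|) * sobolevNorm 1 (fun x => ratInterp β n f x - f x) ≤
            ENNReal.ofReal (C * (1 + |k|) * (n : ℝ) ^ (1 + ε - s)) *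
              periodicSobolevNorm s (pullback β f)) ∧
        (eLpNorm (lineError β k n f σ δ) 2 volume ≤
            eLpNorm (fun x => ratInterp β n f x - f x) 2 volume ∧
          eLpNorm (fun x => ratInterp β n f x - f x) 2 volume ≤
            ENNReal.ofReal (C * (n : ℝ) ^ (1 + ε - s)) *
              periodicSobolevNorm s (pullback β f)) ∧
        ((⨆ x : ℝ, ‖lineError β k n f σ δ x‖ₑ) ≤ sobolevNorm 1 (lineError β k n f σ 0) ∧
          (⨆ x : ℝ, ‖lineError β k n f σ δ x‖ₑ) ≤
            ENNReal.ofReal (C * (1 + |k|) * (n : ℝ) ^ (1 + ε - s)) *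
              periodicSobolevNorm s (pullback β f))) ∧
      -- for fixed `k`, uniform convergence in the whole plane
      TendstoUniformlyOn (fun (n : ℕ) (z : ℂ) => oscCauchyApprox β k n f z) (oscCauchy k f)
          atTop {z : ℂ | z.im ≠ 0} ∧
      ∀ σ : ℤˣ, TendstoUniformly
        (fun (n : ℕ) (x : ℝ) => boundaryValue σ (oscCauchyApprox β k n f) x)
        (boundaryValue σ (oscCauchy k f)) atTop := by
  obtain ⟨C, hC, h⟩ := mainTheorem4_general β hβ ε s hε.le hs
  exact ⟨C, hC, fun f hc hf => h f hc (hf.tendsto_cocompact hc)⟩
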